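/- **Conventions.** A *set system* on $U=\{0,\dots,n-1\}$ is a family $\mathcal I\subseteq 2^U$; it is *downward-closed* if $S\subseteq T\in\mathcal I$ implies $S\in\mathcal I$. Its *polytope* $\mathcal P_{\mathcal I}\subseteq[0,1]^n$ is the convex hull of the indicator vectors of the (inclusion-wise) maximal sets of $\mathcal I$. A function $f:2^U\to\mathbb R$ is *monotone* if $f(S)\le f(T)$ whenever $S\subseteq T$, and *submodular* if $f(S\cup T)+f(S\cap T)\le f(S)+f(T)$ for all $S,T$. A distribution $\mathcal D$ on $2^U$ has *marginals* $\mathbf x$ if $\Pr_{S\sim\mathcal D}[i\in S]=x_i$ for all $i$, and satisfies *Weak Negative Regression* (WNR) if for every $i\in U$ with $0<\Pr_{S\sim\mathcal D}[i\in S]<1$ and every monotone $g:2^U\to\mathbb R$, $$\mathbb E_{S\sim\mathcal D}[g(S\setminus\{i\})\mid i\in S]\;\le\;\mathbb E_{S\sim\mathcal D}[g(S\setminus\{i\})\mid i\notin S].$$ *Algorithms* are randomised real-RAM programs: exact arithmetic and comparisons on real numbers (no rounding; the only built-in real constant is $1$), natural-number counters, lists, general loops, and tosses of coins of any computed bias,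 each operation and oracle query costing one step. Let $\mathcal C$ be a class of set systems. Each member $\mathcal I\subseteq 2^{\{0,\dots,n-1\}}$ is presented to algorithms by $n$, a finite sequence of $m\ge 0$ real numbers, and oracle access to a function assigning a real number to every list of natural numbers (for instance a membership oracle, or a constant). An algorithm is *efficient* on $\mathcal C$ if, for some polynomial $P$, on every member of $\mathcal C$ and for every outcome of its coin tosses it halts after at most $P(n+m)$ steps. * $\mathcal C$ has *solvable polytopes* if an efficient algorithm, given the presentation of any $\mathcal I\in\mathcal C$ and any $c\in\mathbb R^n$, always returns a maximiser of $x\mapsto\sum_i c_ix_i$ over $\mathcal P_{\mathcal I}$. * $\mathcal C$ *efficiently admits WNR distributions* if an efficient algorithm, given the presentation of any $\mathcal I\in\mathcal C$ and any $\mathbf x\in\mathcal P_{\mathcal I}$, returns a random set in $\mathcal I$ whose distribution is WNR with marginals $\mathbf x$. **Theorem (Submodular Maximization).** There is a function $\varepsilon:\mathbb N\to\mathbb R$ with $\varepsilon(n)\to0$ as $n\to\infty$ such that the following holds. Let $\mathcal C$ be a class of downward-closed set systems that has solvable polytopes and efficiently admits WNR distributions. Then there is an efficient algorithm which, given the presentation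 of any $\mathcal I\in\mathcal C$, $\mathcal I\subseteq2^{\{0,\dots,n-1\}}$, and value-oracle access to any monotone submodular function $f:2^{\{0,\dots,n-1\}}\to\mathbb R_{\ge0}$, always returns a set $T\in\mathcal I$, and $$\mathbb E[f(T)]\;\ge\;\Bigl(1-\frac1e-\varepsilon(n)\Bigr)\cdot\max_{S\in\mathcal I}f(S).$$ -/

import Mathlib

/-! ## Randomised real-RAM programs with a step count

A small first-order programming language over natural numbers, exact real numbers, pairs, tagged
unions and lists, with unit-cost operations, general (unbounded) loops, biased coins and oracle
queries.  There is no rounding operation on reals and the only real constants are those computable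
from `1`, so the language is the uniform, constant-free randomised real RAM up to polynomial
overhead. -/

namespace SubmodMax

/-- Data types of the language. -/
inductive Ty : Type
  | unit : Ty
  | nat : Ty
  | real : Ty
  | prod : Ty → Ty → Ty
  | sum : Ty → Ty → Ty
  | list : Ty → Ty

/-- The values of a data type. -/
@[reducible] def Ty.val : Ty → Type
  | .unit => Unit
  | .nat => ℕ
  | .real => ℝ
  | .prod a b => a.val × b.val
  | .sum a b => a.val ⊕ b.val
  | .list a => List a.val

/-- Truth values: `Sum.inl ()` is "yes", `Sum.inr ()` is "no". -/
abbrev Ty.bool : Ty := .sum .unit .unit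

/-- Deterministic primitive operations, each of which takes one step. -/
inductive Prim : Ty → Ty → Type
  | id {a : Ty} : Prim a a
  | unit {a : Ty} : Prim a .unit
  | fst {a b : Ty} : Prim (.prod a b) a
  | snd {a b : Ty} : Prim (.prod a b) b
  | inl {a b : Ty} : Prim a (.sum a b)
  | inr {a b : Ty} : Prim b (.sum a b)
  | nil {a b : Ty} : Prim a (.list b)
  | cons {a : Ty} : Prim (.prod a (.list a)) (.list a)
  | uncons {a : Ty} : Prim (.list a) (.sum .unit (.prod a (.list a)))
  | natZero {a : Ty} : Prim a .nat
  | natSucc : Prim .nat .nat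
  | natPred : Prim .nat (.sum .unit .nat)
  | natAdd : Prim (.prod .nat .nat) .nat
  | natLe : Prim (.prod .nat .nat) .bool
  | natCast : Prim .nat .real
  | realOne {a : Ty} : Prim a .real
  | realAdd : Prim (.prod .real .real) .real
  | realSub : Prim (.prod .real .real) .real
  | realMul : Prim (.prod .real .real) .real
  | realDiv : Prim (.prod .real .real) .real
  | realLe : Prim (.prod .real .real) .bool

/-- The function computed by a primitive operation (division by zero returns zero). -/
noncomputable def Prim.eval : {a b : Ty} → Prim a b → a.val → b.val
  | _, _, .id, x => x
  | _, _, .unit, _ => ()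
  | _, _, .fst, x => x.1
  | _, _, .snd, x => x.2
  | _, _, .inl, x => Sum.inl x
  | _, _, .inr, x => Sum.inr x
  | _, _, .nil, _ => []
  | _, _, .cons, x => x.1 :: x.2
  | _, _, .uncons, [] => Sum.inl ()
  | _, _, .uncons, y :: l => Sum.inr (y, l)
  | _, _, .natZero, _ => (0 : ℕ)
  | _, _, .natSucc, k => k + 1
  | _, _, .natPred, 0 => Sum.inl ()
  | _, _, .natPred, k + 1 => Sum.inr k
  | _, _, .natAdd, x => x.1 + x.2
  | _, _, .natLe, x => if x.1 ≤ x.2 then Sum.inl () else Sum.inr ()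
  | _, _, .natCast, k => (k : ℝ)
  | _, _, .realOne, _ => (1 : ℝ)
  | _, _, .realAdd, x => x.1 + x.2
  | _, _, .realSub, x => x.1 - x.2
  | _, _, .realMul, x => x.1 * x.2
  | _, _, .realDiv, x => x.1 / x.2
  | _, _, .realLe, x => if x.1 ≤ x.2 then Sum.inl () else Sum.inr ()

/-- Programs with input of type `a` and output of type `b`. -/
inductive Prog : Ty → Ty → Type
  /-- a primitive operation -/
  | prim {a b : Ty} : Prim a b → Prog a b
  /-- toss a coin whose bias is the given real number -/
  | flip : Prog .real .bool
  /-- query the oracle through which the set system is presented -/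
  | askSystem : Prog (.list .nat) .real
  /-- query the value oracle of the objective function -/
  | askValue : Prog (.list .nat) .real
  /-- run the first program, then the second one on its output -/
  | comp {a b c : Ty} : Prog a b → Prog b c → Prog a c
  /-- run both programs on the input and return the pair of outputs -/
  | pair {a b c : Ty} : Prog a b → Prog a c → Prog a (.prod b c)
  /-- branch on the tag of the first component -/
  | case {a b c d : Ty} : Prog (.prod a c) d → Prog (.prod b c) d → Prog (.prod (.sum a b) c) d
  /-- repeat the body on its own output as long as it returns `Sum.inl` -/
  | loop {a b : Ty} : Prog a (.sum a b) → Prog a b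

/-- The program contains no query to the value oracle of the objective function. -/
def Prog.NoValueQuery : {a b : Ty} → Prog a b → Prop
  | _, _, .prim _ => True
  | _, _, .flip => True
  | _, _, .askSystem => True
  | _, _, .askValue => False
  | _, _, .comp p q => p.NoValueQuery ∧ q.NoValueQuery
  | _, _, .pair p q => p.NoValueQuery ∧ q.NoValueQuery
  | _, _, .case p q => p.NoValueQuery ∧ q.NoValueQuery
  | _, _, .loop p => p.NoValueQuery

/-- A coin that shows `Sum.inl ()` with probability `p` (with `p` clamped to `[0, 1]`). -/
noncomputable def coin (p : ℝ) : PMF (Unit ⊕ Unit) :=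
  PMF.ofFintype
    (fun s => Sum.elim (fun _ => ENNReal.ofReal (max 0 (min 1 p)))
      (fun _ => ENNReal.ofReal (1 - max 0 (min 1 p))) s)
    (by
      have h0 : 0 ≤ max 0 (min 1 p) := le_max_left _ _
      have h1 : max 0 (min 1 p) ≤ 1 := max_le zero_le_one (min_le_left _ _)
      simp only [Fintype.sum_sum_type, Sum.elim_inl, Sum.elim_inr, Finset.univ_unique,
        Finset.sum_singleton]
      rw [← ENNReal.ofReal_add h0 (by linarith)]
      simp)

/-- Big-step semantics.  `Eval A V p x D` says: with oracles `A` (for the set system) and `V` (for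
the objective function), the program `p` started on input `x` halts on every outcome of its coin
tosses, and `D` is the joint distribution of its output and of its number of steps.  Distinct coin
tosses are independent. -/
inductive Eval (A V : List ℕ → ℝ) :
    {a b : Ty} → Prog a b → a.val → PMF (b.val × ℕ) → Prop
  | prim {a b : Ty} (o : Prim a b) (x : a.val) :
      Eval A V (.prim o) x (PMF.pure (o.eval x, 1))
  | flip (r : ℝ) :
      Eval A V .flip r ((coin r).map fun s => (s, 1))
  | askSystem (l : List ℕ) :
      Eval A V .askSystem l (PMF.pure (A l, 1))
  | askValue (l : List ℕ) :
      Eval A V .askValue l (PMF.pure (V l, 1))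
  | comp {a b c : Ty} (p : Prog a b) (q : Prog b c) (x : a.val)
      (D : PMF (b.val × ℕ)) (K : b.val → PMF (c.val × ℕ)) :
      Eval A V p x D →
      (∀ y ∈ D.support, Eval A V q y.1 (K y.1)) →
      Eval A V (.comp p q) x (D.bind fun y => (K y.1).map fun z => (z.1, y.2 + z.2 + 1))
  | pair {a b c : Ty} (p : Prog a b) (q : Prog a c) (x : a.val)
      (D : PMF (b.val × ℕ)) (E : PMF (c.val × ℕ)) :
      Eval A V p x D →
      Eval A V q x E →
      Eval A V (.pair p q) x (D.bind fun y => E.map fun z => ((y.1, z.1), y.2 + z.2 + 1))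
  | caseInl {a b c d : Ty} (p : Prog (.prod a c) d) (q : Prog (.prod b c) d)
      (u : a.val) (w : c.val) (D : PMF (d.val × ℕ)) :
      Eval A V p (u, w) D →
      Eval A V (.case p q) (Sum.inl u, w) (D.map fun z => (z.1, z.2 + 1))
  | caseInr {a b c d : Ty} (p : Prog (.prod a c) d) (q : Prog (.prod b c) d)
      (u : b.val) (w : c.val) (D : PMF (d.val × ℕ)) :
      Eval A V q (u, w) D →
      Eval A V (.case p q) (Sum.inr u, w) (D.map fun z => (z.1, z.2 + 1))
  | loop {a b : Ty} (p : Prog a (.sum a b)) (x : a.val)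
      (D : PMF ((a.val ⊕ b.val) × ℕ)) (K : a.val → PMF (b.val × ℕ)) :
      Eval A V p x D →
      (∀ (y : a.val) (t : ℕ), (Sum.inl y, t) ∈ D.support → Eval A V (.loop p) y (K y)) →
      Eval A V (.loop p) x (D.bind fun o =>
        Sum.elim (fun y => (K y).map fun z => (z.1, o.2 + z.2 + 1))
          (fun z => PMF.pure (z, o.2 + 1)) o.1)

/-! ## Set systems, polytopes, negative dependence -/

/-- A submodular set function. -/
def Submodular {n : ℕ} (f : Finset (Fin n) → ℝ) : Prop :=
  ∀ S T, f (S ∪ T) + f (S ∩ T) ≤ f S + f T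

/-- The polytope of a set system: the convex hull of the indicator vectors of its maximal sets. -/
def polytope {n : ℕ} (I : Finset (Finset (Fin n))) : Set (Fin n → ℝ) :=
  convexHull ℝ {x | ∃ S, Maximal (· ∈ I) S ∧ x = fun i => if i ∈ S then (1 : ℝ) else 0}

/-- The probability of the event `E` under `D`. -/
noncomputable def prob {n : ℕ} (D : PMF (Finset (Fin n))) (E : Finset (Fin n) → Prop)
    [DecidablePred E] : ℝ :=
  ∑ S with E S, (D S).toReal

/-- The expectation of `g(S)` for `S ∼ D`. -/
noncomputable def expect {n : ℕ} (D : PMF (Finset (Fin n))) (g : Finset (Fin n) → ℝ) : ℝ :=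
  ∑ S, (D S).toReal * g S

/-- The expectation of `g(S)` for `S ∼ D` conditioned on the event `E` (of positive probability). -/
noncomputable def condExpect {n : ℕ} (D : PMF (Finset (Fin n))) (E : Finset (Fin n) → Prop)
    [DecidablePred E] (g : Finset (Fin n) → ℝ) : ℝ :=
  (∑ S with E S, (D S).toReal * g S) / prob D E

/-- Weak Negative Regression.  The condition on `i` is void when one of the two conditional
expectations is undefined. -/
def IsWNR {n : ℕ} (D : PMF (Finset (Fin n))) : Prop :=
  ∀ i : Fin n, 0 < prob D (fun S => i ∈ S) → 0 < prob D (fun S => i ∉ S) →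
    ∀ g : Finset (Fin n) → ℝ, Monotone g →
      condExpect D (fun S => i ∈ S) (fun S => g (S.erase i)) ≤
        condExpect D (fun S => i ∉ S) (fun S => g (S.erase i))

/-- `x` is the vector of marginals of `D`. -/
def HasMarginals {n : ℕ} (D : PMF (Finset (Fin n))) (x : Fin n → ℝ) : Prop :=
  ∀ i, prob D (fun S => i ∈ S) = x i

/-- `D` is a distribution over the set system `I`. -/
def SupportedOn {n : ℕ} (D : PMF (Finset (Fin n))) (I : Finset (Finset (Fin n))) : Prop :=
  ∀ S ∈ D.support, S ∈ I

/-! ## Efficient algorithms on classes of set systems -/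

/-- A set system on the ground set `{0, …, n - 1}`, together with the way it is presented to an
algorithm: a finite sequence of reals `desc` (part of the input, e.g. a list of edges or weights; it
may be empty), and an oracle (e.g. for membership; it may be constant). -/
structure Instance where
  n : ℕ
  sets : Finset (Finset (Fin n))
  desc : List ℝ
  oracle : List ℕ → ℝ

/-- The part of an algorithm's input that presents the set system: `n` and `desc`. -/
abbrev Ty.pres : Ty := .prod .nat (.list .real)

/-- The input that presents the set system. -/
def Instance.pres (X : Instance) : Ty.pres.val := (X.n, X.desc)

/-- The input size in which running times are measured. -/
def Instance.size (X : Instance) : ℕ := X.n + X.desc.length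

/-- The subset of `{0, …, n - 1}` listed by a list of numbers. -/
def toSet (n : ℕ) (l : List ℕ) : Finset (Fin n) := {i | (i : ℕ) ∈ l}

/-- The value oracle of a set function. -/
def valueOracle {n : ℕ} (f : Finset (Fin n) → ℝ) : List ℕ → ℝ := fun l => f (toSet n l)

/-- The distribution of the set returned by a program whose output and running time have joint
distribution `D`. -/
noncomputable def outSet (n : ℕ) (D : PMF (List ℕ × ℕ)) : PMF (Finset (Fin n)) :=
  D.map fun y => toSet n y.1

/-- Every run takes at most `T` steps. -/
def TimeAtMost {b : Ty} (D : PMF (b.val × ℕ)) (T : ℕ) : Prop :=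
  ∀ y ∈ D.support, y.2 ≤ T

/-- The polytopes of the set systems of the class are solvable: a randomised polynomial-time program
maximises every linear objective `c` over them. -/
def Solvable (C : Set Instance) : Prop :=
  ∃ (p : Prog (.prod .pres (.list .real)) (.list .real)) (P : Polynomial ℕ),
    p.NoValueQuery ∧
    ∀ X ∈ C, ∀ c : Fin X.n → ℝ, ∃ D : PMF (List ℝ × ℕ),
      Eval X.oracle (fun _ => 0) p (X.pres, List.ofFn c) D ∧
      TimeAtMost (b := .list .real) D (P.eval X.size) ∧
      ∀ y ∈ D.support, ∃ x ∈ polytope X.sets, y.1 = List.ofFn x ∧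
        ∀ z ∈ polytope X.sets, ∑ i, c i * z i ≤ ∑ i, c i * x i

/-- The set systems of the class efficiently admit WNR distributions: a randomised polynomial-time
program samples, for every point `x` of the polytope, from a WNR distribution over the set system
with marginals `x`. -/
def EfficientlyAdmitsWNR (C : Set Instance) : Prop :=
  ∃ (p : Prog (.prod .pres (.list .real)) (.list .nat)) (P : Polynomial ℕ),
    p.NoValueQuery ∧
    ∀ X ∈ C, ∀ x ∈ polytope X.sets, ∃ D : PMF (List ℕ × ℕ),
      Eval X.oracle (fun _ => 0) p (X.pres, List.ofFn x) D ∧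
      TimeAtMost (b := .list .nat) D (P.eval X.size) ∧
      SupportedOn (outSet X.n D) X.sets ∧
      IsWNR (outSet X.n D) ∧
      HasMarginals (outSet X.n D) x

end SubmodMax

/-! Let `F` be the multilinear extension of `f` and `O` an optimal set.  Continuous greedy starts at
`0` and takes `(n + 1) ^ 2` steps of length `(n + 1)⁻²`, each in the direction of a point of the
polytope that maximises an estimate of the gradient of `F` obtained by sampling.  Up to an expected
error `O(f(O) / n)`, the gradient of `F` at `x` gains at least `f(O) - F(x)` in the best direction,
and only a fraction `O(1 / n)` of this gain is lost because the step has positive length.  So the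
expected gap `f(O) - F(x)`, less the error, shrinks by a factor `1 - (1 - O(1 / n)) / (n + 1) ^ 2`
per step, and all steps together leave about `1 / e` of it.  The final point lies in the
polytope, as an average of points of the polytope.

Rounding loses nothing: if the distribution of `T` is WNR with marginals `x` and `R` contains each
element independently with probability given by `x`, then `E f(T) ≥ E f(R) = F(x)`, as one sees by
resampling the elements of `T` independently one at a time.  Since the discrete derivative of `f` in
direction `i` is antitone, WNR says that the events `i ∈ T` correlate nonnegatively with it. -/

namespace SubmodMax

/-! ## The multilinear extension -/

section SetFunctions

variable {α : Type*} [DecidableEq α] {f g : Finset α → ℝ} {x y : α → ℝ} {s : Finset α} {p : ℝ}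
  {i : α}

/-- The operator taking a set function to its discrete derivative in direction `i`. -/
def marginal (i : α) : Module.End ℝ (Finset α → ℝ) where
  toFun f S := f (insert i S) - f S
  map_add' f g := by ext S; simp only [Pi.add_apply]; ring
  map_smul' c f := by ext S; simp only [Pi.smul_apply, smul_eq_mul, RingHom.id_apply]; ring

theorem marginal_apply (i : α) (f : Finset α → ℝ) (S : Finset α) :
    marginal i f S = f (insert i S) - f S := rfl

theorem marginal_nonneg (hf : Monotone f) (i : α) (S : Finset α) : 0 ≤ marginal i f S :=
  sub_nonneg.2 (hf (Finset.subset_insert i S))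

theorem marginal_mul_self (i : α) : marginal i * marginal i = -marginal i := by
  ext f S
  simp [marginal_apply]

theorem commute_marginal (i j : α) : Commute (marginal i) (marginal j) := by
  ext f S
  simp only [Module.End.mul_apply, marginal_apply, Finset.insert_comm j i]
  ring

/-- `insertWithProb p i f S` is the expectation of `f` at the set obtained from `S` by inserting `i`
with probability `p`. -/
def insertWithProb (p : ℝ) (i : α) : Module.End ℝ (Finset α → ℝ) := 1 + p • marginal i

theorem insertWithProb_apply (p : ℝ) (i : α) (f : Finset α → ℝ) (S : Finset α) :
    insertWithProb p i f S = (1 - p) * f S + p * f (insert i S) := by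
  simp only [insertWithProb, LinearMap.add_apply, Module.End.one_apply, LinearMap.smul_apply,
    Pi.add_apply, Pi.smul_apply, smul_eq_mul, marginal_apply]
  ring

theorem commute_insertWithProb (p q : ℝ) (i j : α) :
    Commute (insertWithProb p i) (insertWithProb q j) :=
  ((Commute.one_right _).add_right <| ((Commute.one_left _).add_left
    ((commute_marginal i j).smul_left p)).smul_right q)

theorem insertWithProb_mul (p q : ℝ) (i : α) :
    insertWithProb p i * insertWithProb q i = insertWithProb (p + q - p * q) i := by
  simp only [insertWithProb, mul_add, add_mul, one_mul, mul_one, smul_mul_smul_comm,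
    marginal_mul_self]
  module

theorem insertWithProb_mono (hp : p ∈ Set.Icc 0 1) (i : α) : Monotone (insertWithProb p i) := by
  intro f g h S
  rw [insertWithProb_apply, insertWithProb_apply]
  have := sub_nonneg.2 hp.2
  have := hp.1
  gcongr <;> apply h

theorem insertWithProb_monotone (hf : Monotone f) (hp : p ∈ Set.Icc 0 1) (i : α) :
    Monotone (insertWithProb p i f) := by
  intro S T h
  rw [insertWithProb_apply, insertWithProb_apply]
  have := sub_nonneg.2 hp.2
  have := hp.1
  gcongr
  · exact hf h
  · exact hf (Finset.insert_subset_insert i h)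

theorem le_insertWithProb (hf : Monotone f) (hp : 0 ≤ p) (i : α) : f ≤ insertWithProb p i f := by
  intro S
  rw [insertWithProb_apply]
  nlinarith [mul_nonneg hp (sub_nonneg.2 (hf (Finset.subset_insert i S)))]

/-- `multilinear x s f S` is the expectation of `f (S ∪ R)` for a random `R ⊆ s` that contains each
`i ∈ s` independently with probability `x i`.  In particular `multilinear x univ f ∅` is the value
of the multilinear extension of `f` at `x`. -/
def multilinear (x : α → ℝ) (s : Finset α) : Module.End ℝ (Finset α → ℝ) :=
  s.noncommProd (fun i => insertWithProb (x i) i) fun i _ j _ _ =>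
    commute_insertWithProb (x i) (x j) i j

@[simp] theorem multilinear_empty (x : α → ℝ) : multilinear x ∅ = 1 := Finset.noncommProd_empty _ _

theorem multilinear_insert (x : α → ℝ) (hi : i ∉ s) :
    multilinear x (insert i s) = insertWithProb (x i) i * multilinear x s :=
  Finset.noncommProd_insert_of_notMem _ _ _ _ hi

theorem multilinear_insert_apply (x : α → ℝ) (hi : i ∉ s) (f : Finset α → ℝ) (S : Finset α) :
    multilinear x (insert i s) f S =
      (1 - x i) * multilinear x s f S + x i * multilinear x s f (insert i S) := by
  rw [multilinear_insert x hi, Module.End.mul_apply, insertWithProb_apply]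

theorem multilinear_induction {P : Module.End ℝ (Finset α → ℝ) → Prop}
    (mul : ∀ M N, P M → P N → P (M * N)) (one : P 1) (ins : ∀ i, P (insertWithProb (x i) i))
    (s : Finset α) : P (multilinear x s) :=
  Finset.noncommProd_induction _ _ _ P mul one fun i _ => ins i

theorem commute_multilinear_marginal (x : α → ℝ) (s : Finset α) (i : α) :
    Commute (multilinear x s) (marginal i) :=
  multilinear_induction (P := (Commute · (marginal i))) (fun _ _ => Commute.mul_left)
    (Commute.one_left _) (fun _ => (Commute.one_left _).add_left
      ((commute_marginal _ i).smul_left _)) s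

theorem multilinear_const (x : α → ℝ) (s : Finset α) (c : ℝ) :
    multilinear x s (fun _ => c) = fun _ => c :=
  multilinear_induction (P := fun M => M (fun _ => c) = fun _ => c)
    (fun _ _ h h' => by rw [Module.End.mul_apply, h', h]) rfl
    (fun _ => funext fun _ => by rw [insertWithProb_apply]; ring) s

theorem multilinear_mono (hx : ∀ i, x i ∈ Set.Icc 0 1) (s : Finset α) :
    Monotone (multilinear x s) :=
  multilinear_induction (P := fun M => Monotone M) (fun _ _ h h' => h.comp h') monotone_id
    (fun i => insertWithProb_mono (hx i) i) s

theorem multilinear_monotone (hf : Monotone f) (hx : ∀ i, x i ∈ Set.Icc 0 1) (s : Finset α) :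
    Monotone (multilinear x s f) :=
  multilinear_induction (P := fun M => ∀ f, Monotone f → Monotone (M f))
    (fun _ _ h h' f hf => h _ (h' f hf)) (fun _ hf => hf)
    (fun i _ hf => insertWithProb_monotone hf (hx i) i) s f hf

theorem le_multilinear (hf : Monotone f) (hx : ∀ i, x i ∈ Set.Icc 0 1) (s : Finset α) :
    f ≤ multilinear x s f := by
  induction s using Finset.induction_on with
  | empty => simp
  | insert i s hi ih =>
    rw [multilinear_insert x hi]
    exact ih.trans (le_insertWithProb (multilinear_monotone hf hx s) ((hx i).1) i)

theorem multilinear_mul (x y : α → ℝ) (s : Finset α) :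
    multilinear x s * multilinear y s = multilinear (x + y - x * y) s := by
  refine (Finset.noncommProd_mul_distrib _ _ _ _ fun i _ j _ _ =>
    commute_insertWithProb _ _ _ _).symm.trans ?_
  exact Finset.noncommProd_congr rfl (fun i _ => insertWithProb_mul _ _ i) _

theorem multilinear_mono_left (hf : Monotone f) (hx : ∀ i, x i ∈ Set.Icc 0 1)
    (hy : ∀ i, y i ∈ Set.Icc 0 1) (hxy : x ≤ y) (s : Finset α) :
    multilinear x s f ≤ multilinear y s f := by
  induction s using Finset.induction_on with
  | empty => simp
  | insert i s hi ih =>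
    intro S
    rw [multilinear_insert_apply x hi, multilinear_insert_apply y hi]
    have hi' := multilinear_monotone hf hx s (Finset.subset_insert i S)
    nlinarith [mul_nonneg (sub_nonneg.2 (hxy i)) (sub_nonneg.2 hi'),
      mul_le_mul_of_nonneg_left (ih S) (sub_nonneg.2 ((hy i).2)),
      mul_le_mul_of_nonneg_left (ih (insert i S)) ((hy i).1)]

theorem add_sum_marginal_le_multilinear (hf : Monotone f) (hy : ∀ i, y i ∈ Set.Icc 0 1)
    (s S : Finset α) :
    f S + (1 - ∑ i ∈ s, y i) * ∑ i ∈ s, y i * marginal i f S ≤ multilinear y s f S := by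
  induction s using Finset.induction_on with
  | empty => simp
  | insert i s hi ih =>
    rw [multilinear_insert_apply y hi, Finset.sum_insert hi, Finset.sum_insert hi]
    set c := ∑ j ∈ s, y j
    set D := ∑ j ∈ s, y j * marginal j f S
    have hc : 0 ≤ c := Finset.sum_nonneg fun j _ => (hy j).1
    have hD : 0 ≤ D := Finset.sum_nonneg fun j _ => mul_nonneg ((hy j).1) (marginal_nonneg hf j S)
    have hyi : 0 ≤ y i := (hy i).1
    have hΔ : 0 ≤ y i * marginal i f S := mul_nonneg hyi (marginal_nonneg hf i S)
    calc f S + (1 - (y i + c)) * (y i * marginal i f S + D)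
        = (1 - y i) * (f S + (1 - c) * D) + y i * f (insert i S)
          - ((y i + c) * (y i * marginal i f S) + y i * c * D) := by rw [marginal_apply]; ring
      _ ≤ (1 - y i) * (f S + (1 - c) * D) + y i * f (insert i S) := by
          rw [sub_le_self_iff]; positivity
      _ ≤ (1 - y i) * multilinear y s f S + y i * multilinear y s f (insert i S) :=
          add_le_add (mul_le_mul_of_nonneg_left ih (sub_nonneg.2 ((hy i).2)))
            (mul_le_mul_of_nonneg_left (le_multilinear hf hy s _) hyi)

-- Taking the union of independent random sets with inclusion probabilities `x` and `y` gives
-- `x + y - x * y ≤ x + y`.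
theorem multilinear_add_le (hf : Monotone f) (hx : ∀ i, x i ∈ Set.Icc 0 1)
    (hy : ∀ i, y i ∈ Set.Icc 0 1) (hxy : ∀ i, x i + y i ≤ 1) (s S : Finset α) :
    multilinear x s f S + (1 - ∑ i ∈ s, y i) * ∑ i ∈ s, y i * multilinear x s (marginal i f) S ≤
      multilinear (x + y) s f S := by
  have hcomm (i : α) : multilinear x s (marginal i f) = marginal i (multilinear x s f) :=
    LinearMap.congr_fun (commute_multilinear_marginal x s i).eq f
  have hle : x + y - x * y ≤ x + y :=
    sub_le_self _ (mul_nonneg (fun i => (hx i).1) fun i => (hy i).1)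
  have hsum : ∀ i, (x + y) i ∈ Set.Icc 0 1 := fun i => ⟨add_nonneg (hx i).1 (hy i).1, hxy i⟩
  have hunion : ∀ i, (x + y - x * y) i ∈ Set.Icc 0 1 := fun i =>
    ⟨by simpa [add_sub_assoc, ← one_sub_mul] using
      add_nonneg (hx i).1 (mul_nonneg (sub_nonneg.2 (hx i).2) (hy i).1), (hle i).trans (hxy i)⟩
  simp only [hcomm]
  calc _ ≤ multilinear y s (multilinear x s f) S :=
        add_sum_marginal_le_multilinear (multilinear_monotone hf hx s) hy s S
    _ = multilinear (x + y - x * y) s f S := by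
        rw [← Module.End.mul_apply, multilinear_mul, add_comm y x, mul_comm y x]
    _ ≤ multilinear (x + y) s f S := multilinear_mono_left hf hunion hsum hle s S

theorem multilinear_add_smul_le (hf : Monotone f) (hx : ∀ i, x i ∈ Set.Icc 0 1)
    (hy : ∀ i, y i ∈ Set.Icc 0 1) {δ : ℝ} (hδ : 0 ≤ δ) (hxy : ∀ i, x i + δ * y i ≤ 1)
    (s S : Finset α) :
    multilinear x s f S +
        (1 - s.card * δ) * (δ * ∑ i ∈ s, y i * multilinear x s (marginal i f) S) ≤
      multilinear (x + δ • y) s f S := by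
  have hδy (i : α) : (δ • y) i ∈ Set.Icc 0 1 :=
    ⟨mul_nonneg hδ (hy i).1, (le_add_of_nonneg_left (hx i).1).trans (hxy i)⟩
  have hcard : ∑ i ∈ s, δ * y i ≤ s.card * δ := by
    rw [← nsmul_eq_mul]
    exact Finset.sum_le_card_nsmul s _ _ fun i _ => mul_le_of_le_one_right hδ (hy i).2
  have hgrad (i : α) : 0 ≤ multilinear x s (marginal i f) S := by
    simpa only [multilinear_const] using multilinear_mono hx s (marginal_nonneg hf i) S
  refine le_trans ?_ (multilinear_add_le hf hx hδy hxy s S)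
  simp only [Pi.smul_apply, smul_eq_mul, mul_assoc, ← Finset.mul_sum] at hcard ⊢
  gcongr
  exact mul_nonneg hδ (Finset.sum_nonneg fun i _ => mul_nonneg (hy i).1 (hgrad i))

theorem multilinear_sq_sub_le (hx : ∀ i, x i ∈ Set.Icc 0 1) (s S : Finset α) {b : ℝ}
    (hf : ∀ R, |f R| ≤ b) (c : ℝ) :
    multilinear x s (fun R => (c + (f R - multilinear x s f S)) ^ 2) S ≤ c ^ 2 + b ^ 2 := by
  set m := multilinear x s f S with hm
  have hexpand : (fun R => (c + (f R - m)) ^ 2) =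
      (fun R => f R ^ 2) + (2 * (c - m)) • f + fun _ => (c - m) ^ 2 := by
    ext R
    simp only [Pi.add_apply, Pi.smul_apply, smul_eq_mul]
    ring
  have hsq : multilinear x s (fun R => f R ^ 2) S ≤ b ^ 2 :=
    (multilinear_mono hx s (fun R => sq_le_sq' (neg_le_of_abs_le (hf R)) (le_of_abs_le (hf R)))
      S).trans_eq (by rw [multilinear_const])
  rw [hexpand, map_add, map_add, map_smul, multilinear_const]
  simp only [Pi.add_apply, Pi.smul_apply, smul_eq_mul, ← hm]
  nlinarith [sq_nonneg m]

end SetFunctions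

section Submodular

variable {n : ℕ} {f : Finset (Fin n) → ℝ}

theorem Submodular.marginal_le_of_notMem (hf : Submodular f) {S T : Finset (Fin n)} (h : S ⊆ T)
    {i : Fin n} (hi : i ∉ T) : marginal i f T ≤ marginal i f S := by
  have hST := hf (insert i S) T
  rw [Finset.insert_union, Finset.union_eq_right.2 h, Finset.insert_inter_of_notMem hi,
    Finset.inter_eq_left.2 h] at hST
  linarith [marginal_apply i f S, marginal_apply i f T]

theorem Submodular.antitone_marginal_erase (hf : Submodular f) (i : Fin n) :
    Antitone fun S : Finset (Fin n) => marginal i f (S.erase i) := fun _ T h =>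
  hf.marginal_le_of_notMem (Finset.erase_subset_erase i h) (Finset.notMem_erase i T)

theorem Submodular.antitone_marginal (hf : Submodular f) (hm : Monotone f) (i : Fin n) :
    Antitone (marginal i f) := by
  intro S T h
  by_cases hi : i ∈ T
  · rw [marginal_apply i f T, Finset.insert_eq_of_mem hi, sub_self]
    exact marginal_nonneg hm i S
  · exact hf.marginal_le_of_notMem h hi

theorem Submodular.marginal_le_singleton (hf : Submodular f) (h0 : ∀ S, 0 ≤ f S) (i : Fin n)
    (S : Finset (Fin n)) : marginal i f S ≤ f {i} := by
  have := hf {i} S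
  rw [← Finset.insert_eq] at this
  linarith [h0 ({i} ∩ S), marginal_apply i f S]

theorem Submodular.sub_le_sum_marginal (hf : Submodular f) (hm : Monotone f)
    (O S : Finset (Fin n)) : f O - f S ≤ ∑ i ∈ O, marginal i f S := by
  suffices f (O ∪ S) - f S ≤ ∑ i ∈ O, marginal i f S by
    linarith [hm (Finset.subset_union_left (s₁ := O) (s₂ := S))]
  induction O using Finset.induction_on with
  | empty => simp
  | insert i O hi ih =>
    rw [Finset.sum_insert hi, Finset.insert_union]
    have := hf.antitone_marginal hm i (Finset.subset_union_right (s₁ := O) (s₂ := S))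
    linarith [marginal_apply i f (O ∪ S)]

theorem Submodular.insertWithProb {p : ℝ} (hp : p ∈ Set.Icc 0 1) (i : Fin n) (hf : Submodular f) :
    Submodular (insertWithProb p i f) := by
  intro S T
  simp only [insertWithProb_apply, Finset.insert_union_distrib, Finset.insert_inter_distrib]
  linarith [mul_le_mul_of_nonneg_left (hf S T) (sub_nonneg.2 hp.2),
    mul_le_mul_of_nonneg_left (hf (insert i S) (insert i T)) hp.1]

theorem Submodular.multilinear {x : Fin n → ℝ} (hx : ∀ i, x i ∈ Set.Icc 0 1)
    (s : Finset (Fin n)) (hf : Submodular f) : Submodular (multilinear x s f) :=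
  multilinear_induction (P := fun M => ∀ f, Submodular f → Submodular (M f))
    (fun _ _ h h' f hf => h _ (h' f hf)) (fun _ hf => hf)
    (fun i _ hf => hf.insertWithProb (hx i) i) s f hf

theorem Submodular.sub_multilinear_le (hf : Submodular f) (hm : Monotone f) {x : Fin n → ℝ}
    (hx : ∀ i, x i ∈ Set.Icc 0 1) (s O S : Finset (Fin n)) :
    f O - SubmodMax.multilinear x s f S ≤
      ∑ i ∈ O, SubmodMax.multilinear x s (marginal i f) S := by
  have hle : (fun _ => f O) - f ≤ ∑ i ∈ O, marginal i f := fun R => by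
    simpa only [Pi.sub_apply, Finset.sum_apply] using hf.sub_le_sum_marginal hm O R
  have := multilinear_mono hx s hle S
  rwa [map_sub, multilinear_const, map_sum, Finset.sum_apply] at this

end Submodular

/-! ## Weak negative regression implies submodular dominance -/

section WeakNegativeRegression

variable {n : ℕ} {D : PMF (Finset (Fin n))} {f g : Finset (Fin n) → ℝ} {x : Fin n → ℝ}

theorem prob_nonneg (E : Finset (Fin n) → Prop) [DecidablePred E] : 0 ≤ prob D E :=
  Finset.sum_nonneg fun _ _ => ENNReal.toReal_nonneg

theorem sum_toReal_univ (D : PMF (Finset (Fin n))) : ∑ S, (D S).toReal = 1 := by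
  rw [← ENNReal.toReal_sum fun S _ => D.apply_ne_top S, ← tsum_fintype (L := .unconditional _),
    D.tsum_coe, ENNReal.toReal_one]

theorem prob_add_prob_not (E : Finset (Fin n) → Prop) [DecidablePred E] :
    prob D E + prob D (fun S => ¬E S) = 1 :=
  (Finset.sum_filter_add_sum_filter_not _ _ _).trans (sum_toReal_univ D)

theorem HasMarginals.mem_Icc (hx : HasMarginals D x) (i : Fin n) : x i ∈ Set.Icc 0 1 :=
  hx i ▸ ⟨prob_nonneg _, by
    linarith [prob_add_prob_not (D := D) (i ∈ ·), prob_nonneg (D := D) (i ∉ ·)]⟩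

theorem sum_filter_eq_zero_of_prob_eq_zero {E : Finset (Fin n) → Prop} [DecidablePred E]
    (h : prob D E = 0) (g : Finset (Fin n) → ℝ) : ∑ S with E S, (D S).toReal * g S = 0 :=
  Finset.sum_eq_zero fun S hS => by
    rw [(Finset.sum_eq_zero_iff_of_nonneg fun _ _ => ENNReal.toReal_nonneg).1 h S hS, zero_mul]

theorem IsWNR.prob_mul_expect_le (hD : IsWNR D) (hg : Antitone g) (i : Fin n) :
    prob D (i ∈ ·) * expect D (fun S => g (S.erase i)) ≤
      ∑ S with i ∈ S, (D S).toReal * g (S.erase i) := by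
  set A := ∑ S with i ∈ S, (D S).toReal * g (S.erase i) with hA
  set B := ∑ S with i ∉ S, (D S).toReal * g (S.erase i) with hB
  have hAB : expect D (fun S => g (S.erase i)) = A + B :=
    (Finset.sum_filter_add_sum_filter_not _ _ _).symm
  have hprob := prob_add_prob_not (D := D) (i ∈ ·)
  suffices prob D (i ∈ ·) * B ≤ prob D (i ∉ ·) * A by
    rw [hAB]
    linear_combination this + A * hprob
  rcases (prob_nonneg (D := D) (i ∈ ·)).eq_or_lt with hp | hp
  · rw [hA, sum_filter_eq_zero_of_prob_eq_zero hp.symm, ← hp, zero_mul, mul_zero]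
  rcases (prob_nonneg (D := D) (i ∉ ·)).eq_or_lt with hq | hq
  · rw [hB, sum_filter_eq_zero_of_prob_eq_zero hq.symm, ← hq, zero_mul, mul_zero]
  have := hD i hp hq (fun S => -g S) hg.neg
  simp only [condExpect, mul_neg, Finset.sum_neg_distrib] at this
  rw [div_le_div_iff₀ hp hq] at this
  linarith

theorem IsWNR.expect_insertWithProb_le (hD : IsWNR D) (hx : HasMarginals D x) (hf : Submodular f)
    (i : Fin n) : expect D (fun S => insertWithProb (x i) i f (S.erase i)) ≤ expect D f := by
  have hcorr := hD.prob_mul_expect_le (hf.antitone_marginal_erase i) i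
  simp only [Finset.erase_idem, hx i] at hcorr
  calc expect D (fun S => insertWithProb (x i) i f (S.erase i))
      = expect D (fun S => f (S.erase i)) +
          x i * expect D (fun S => marginal i f (S.erase i)) := by
        simp only [expect, Finset.mul_sum, ← Finset.sum_add_distrib, insertWithProb_apply,
          marginal_apply]
        exact Finset.sum_congr rfl fun S _ => by ring
    _ ≤ expect D (fun S => f (S.erase i)) +
          ∑ S with i ∈ S, (D S).toReal * marginal i f (S.erase i) := by gcongr
    _ = expect D f := by
        simp only [expect, Finset.sum_filter, ← Finset.sum_add_distrib]
        refine Finset.sum_congr rfl fun S _ => ?_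
        split_ifs with hi
        · rw [marginal_apply, Finset.insert_erase hi]
          ring
        · rw [Finset.erase_eq_of_notMem hi, add_zero]

theorem IsWNR.expect_multilinear_sdiff_le (hD : IsWNR D) (hx : HasMarginals D x)
    (hf : Submodular f) (s : Finset (Fin n)) :
    expect D (fun S => multilinear x s f (S \ s)) ≤ expect D f := by
  induction s using Finset.induction_on with
  | empty => simp
  | insert i s hi ih =>
    have hsub : Submodular fun S => multilinear x s f (S \ s) := fun S T => by
      have := hf.multilinear hx.mem_Icc s (S \ s) (T \ s)
      rwa [← Finset.union_sdiff_distrib, ← Finset.inf_eq_inter, ← inf_sdiff] at this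
    refine le_trans (le_of_eq ?_) ((hD.expect_insertWithProb_le hx hsub i).trans ih)
    congr 1 with S
    rw [multilinear_insert_apply x hi, insertWithProb_apply, Finset.insert_sdiff_of_notMem _ hi,
      Finset.sdiff_insert, Finset.erase_sdiff_comm]

theorem IsWNR.multilinear_le_expect (hD : IsWNR D) (hx : HasMarginals D x) (hf : Submodular f) :
    multilinear x Finset.univ f ∅ ≤ expect D f := by
  simpa only [Finset.sdiff_eq_empty_iff_subset.2 (Finset.subset_univ _), expect,
    ← Finset.sum_mul, sum_toReal_univ, one_mul] using
    hD.expect_multilinear_sdiff_le hx hf Finset.univ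

end WeakNegativeRegression

/-! ## Finitely supported distributions -/

/-- The expectation of `g` under `μ` (zero if the series does not converge; it is only used for
distributions of finite support). -/
noncomputable def mean {α : Type*} (μ : PMF α) (g : α → ℝ) : ℝ := ∑' a, (μ a).toReal * g a

section Mean

variable {α β : Type*} {μ : PMF α}

theorem mean_eq_sum (g : α → ℝ) {s : Finset α} (hs : μ.support ⊆ s) :
    mean μ g = ∑ a ∈ s, (μ a).toReal * g a :=
  tsum_eq_sum fun a ha => by
    rw [(μ.apply_eq_zero_iff a).2 fun h => ha (hs h), ENNReal.toReal_zero, zero_mul]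

theorem expect_eq_mean {n : ℕ} (D : PMF (Finset (Fin n))) (g : Finset (Fin n) → ℝ) :
    expect D g = mean D g :=
  (mean_eq_sum g (by simp)).symm

theorem mean_pure (a : α) (g : α → ℝ) : mean (PMF.pure a) g = g a := by
  rw [mean_eq_sum g (s := {a}) (by simp)]
  simp

theorem finite_support_bind {κ : α → PMF β} (hμ : μ.support.Finite)
    (hκ : ∀ a ∈ μ.support, (κ a).support.Finite) : (μ.bind κ).support.Finite := by
  rw [PMF.support_bind]
  exact hμ.biUnion hκ

theorem finite_support_map (k : α → β) (hμ : μ.support.Finite) : (μ.map k).support.Finite := by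
  rw [PMF.support_map]
  exact hμ.image k

theorem toReal_bind_apply (hμ : μ.support.Finite) (κ : α → PMF β) (b : β) :
    (μ.bind κ b).toReal = ∑ a ∈ hμ.toFinset, (μ a).toReal * (κ a b).toReal := by
  rw [PMF.bind_apply, tsum_eq_sum (s := hμ.toFinset), ENNReal.toReal_sum]
  · simp only [ENNReal.toReal_mul]
  · exact fun a _ => ENNReal.mul_ne_top (μ.apply_ne_top a) ((κ a).apply_ne_top b)
  · intro a ha
    rw [(μ.apply_eq_zero_iff a).2 fun h => ha (hμ.mem_toFinset.2 h), zero_mul]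

theorem mean_bind {κ : α → PMF β} (hμ : μ.support.Finite)
    (hκ : ∀ a ∈ μ.support, (κ a).support.Finite) (g : β → ℝ) :
    mean (μ.bind κ) g = mean μ fun a => mean (κ a) g := by
  have hb := finite_support_bind hμ hκ
  rw [mean_eq_sum g (s := hb.toFinset) (by simp), mean_eq_sum _ (s := hμ.toFinset) (by simp)]
  simp only [toReal_bind_apply hμ, Finset.sum_mul]
  rw [Finset.sum_comm]
  refine Finset.sum_congr rfl fun a ha => ?_
  rw [mean_eq_sum g (μ := κ a) (s := hb.toFinset), Finset.mul_sum]
  · simp only [mul_assoc]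
  · intro b hb'
    simp only [Set.Finite.coe_toFinset, PMF.mem_support_bind_iff]
    exact ⟨a, hμ.mem_toFinset.1 ha, hb'⟩

theorem mean_map (k : α → β) (hμ : μ.support.Finite) (g : β → ℝ) :
    mean (μ.map k) g = mean μ fun a => g (k a) := by
  rw [← PMF.bind_pure_comp, mean_bind hμ fun a _ => by simp]
  simp only [Function.comp_apply, mean_pure]

theorem mean_mono (hμ : μ.support.Finite) {g h : α → ℝ} (hgh : ∀ a ∈ μ.support, g a ≤ h a) :
    mean μ g ≤ mean μ h := by
  rw [mean_eq_sum g (s := hμ.toFinset) (by simp), mean_eq_sum h (s := hμ.toFinset) (by simp)]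
  exact Finset.sum_le_sum fun a ha => mul_le_mul_of_nonneg_left
    (hgh a (hμ.mem_toFinset.1 ha)) ENNReal.toReal_nonneg

theorem sum_toReal_eq_one (hμ : μ.support.Finite) : ∑ a ∈ hμ.toFinset, (μ a).toReal = 1 := by
  have hsum : ∑' a, μ a = ∑ a ∈ hμ.toFinset, μ a := tsum_eq_sum fun a ha =>
    (μ.apply_eq_zero_iff a).2 fun h => ha (hμ.mem_toFinset.2 h)
  rw [← ENNReal.toReal_sum fun a _ => μ.apply_ne_top a, ← hsum, μ.tsum_coe, ENNReal.toReal_one]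

theorem mean_mul_add (hμ : μ.support.Finite) (c d : ℝ) (g : α → ℝ) :
    mean μ (fun a => c * g a + d) = c * mean μ g + d := by
  simp only [mean_eq_sum (μ := μ) _ (s := hμ.toFinset) (by simp), mul_add, Finset.sum_add_distrib,
    ← Finset.sum_mul, sum_toReal_eq_one hμ, one_mul, mul_left_comm _ c, ← Finset.mul_sum]

theorem sq_mean_le (hμ : μ.support.Finite) (g : α → ℝ) :
    mean μ g ^ 2 ≤ mean μ fun a => g a ^ 2 := by
  have hvar : mean μ (fun a => 2 * mean μ g * g a + -mean μ g ^ 2) ≤ mean μ fun a => g a ^ 2 :=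
    mean_mono hμ fun a _ => by nlinarith [sq_nonneg (g a - mean μ g)]
  rw [mean_mul_add hμ] at hvar
  linarith

end Mean

theorem mean_coin {p : ℝ} (hp : p ∈ Set.Icc 0 1) (g : Unit ⊕ Unit → ℝ) :
    mean (coin p) g = p * g (Sum.inl ()) + (1 - p) * g (Sum.inr ()) := by
  rw [mean_eq_sum g (s := Finset.univ) (by simp)]
  simp [coin, hp.1, hp.2]

/-! ## A quantitative program logic -/

section Within

variable {α β : Type*} {D : PMF (α × ℕ)} {t t' : ℕ} {Q : α → Prop} {R : β → Prop} {φ : α → ℝ}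
  {ψ : β → ℝ} {r : ℝ}

/-- A finitely supported joint distribution `D` of an output and a running time is within the bounds
`t`, `Q`, `φ`, `r` if the running time is at most `t` and the output satisfies `Q` on every outcome,
and the expectation of the potential `φ` of the output is at most `r`. -/
def Within (D : PMF (α × ℕ)) (t : ℕ) (Q : α → Prop) (φ : α → ℝ) (r : ℝ) : Prop :=
  D.support.Finite ∧ (∀ o ∈ D.support, o.2 ≤ t ∧ Q o.1) ∧ mean D (fun o => φ o.1) ≤ r

theorem Within.pure {a : α} {s : ℕ} (hs : s ≤ t) (ha : Q a) (hr : φ a ≤ r) :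
    Within (PMF.pure (a, s)) t Q φ r :=
  ⟨by simp, by simpa using ⟨hs, ha⟩, (mean_pure _ _).trans_le hr⟩

theorem Within.bind {κ : α × ℕ → PMF (β × ℕ)} (hD : Within D t Q φ r)
    (hκ : ∀ a s, (a, s) ∈ D.support → s ≤ t → Q a → Within (κ (a, s)) t' R ψ (φ a)) :
    Within (D.bind κ) t' R ψ r := by
  obtain ⟨hfin, hQ, hr⟩ := hD
  have hκ' : ∀ o ∈ D.support, Within (κ o) t' R ψ (φ o.1) :=
    fun o ho => hκ o.1 o.2 ho (hQ o ho).1 (hQ o ho).2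
  refine ⟨finite_support_bind hfin fun o ho => (hκ' o ho).1, fun z hz => ?_, ?_⟩
  · obtain ⟨o, ho, hz⟩ := (PMF.mem_support_bind_iff _ _ _).1 hz
    exact (hκ' o ho).2.1 z hz
  · rw [mean_bind hfin fun o ho => (hκ' o ho).1]
    exact (mean_mono hfin fun o ho => (hκ' o ho).2.2).trans hr

theorem Within.map {k : α × ℕ → β × ℕ} (hD : Within D t Q φ r)
    (hk : ∀ a s, s ≤ t → Q a → (k (a, s)).2 ≤ t' ∧ R (k (a, s)).1 ∧ ψ (k (a, s)).1 ≤ φ a) :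
    Within (D.map k) t' R ψ r := by
  rw [← PMF.bind_pure_comp]
  exact hD.bind fun a s _ hs ha =>
    let ⟨ht, hR, hψ⟩ := hk a s hs ha
    .pure ht hR hψ

end Within

section Eval

variable {A V : List ℕ → ℝ} {a b : Ty} {p : Prog a b} {x : a.val} {D : PMF (b.val × ℕ)}

theorem Eval.finite_support (h : Eval A V p x D) : D.support.Finite := by
  induction h with
  | prim | askSystem | askValue => simp
  | flip => exact finite_support_map _ (Set.toFinite _)
  | comp _ _ _ _ _ _ _ ihp ihq =>
    exact finite_support_bind ihp fun y hy => finite_support_map _ (ihq y hy)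
  | pair _ _ _ _ _ _ _ ihp ihq =>
    exact finite_support_bind ihp fun _ _ => finite_support_map _ ihq
  | caseInl _ _ _ _ _ _ ih | caseInr _ _ _ _ _ _ ih => exact finite_support_map _ ih
  | loop _ _ _ _ _ _ ihp ihloop =>
    refine finite_support_bind ihp ?_
    rintro ⟨y | z, s⟩ hy
    · exact finite_support_map _ (ihloop y s hy)
    · simp

theorem Eval.change_valueOracle (h : Eval A V p x D) (hp : p.NoValueQuery) (V' : List ℕ → ℝ) :
    Eval A V' p x D := by
  induction h with
  | prim o x => exact .prim o x
  | flip r => exact .flip r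
  | askSystem l => exact .askSystem l
  | askValue l => exact hp.elim
  | comp p q x D K _ _ ihp ihq => exact .comp p q x D K (ihp hp.1) fun y hy => ihq y hy hp.2
  | pair p q x D E _ _ ihp ihq => exact .pair p q x D E (ihp hp.1) (ihq hp.2)
  | caseInl p q u w D _ ih => exact .caseInl p q u w D (ih hp.1)
  | caseInr p q u w D _ ih => exact .caseInr p q u w D (ih hp.2)
  | loop p x D K _ _ ihp ihloop =>
    exact .loop p x D K (ihp hp) fun y s hy => ihloop y s hy hp

end Eval

instance Ty.nonempty_val : (a : Ty) → Nonempty a.val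
  | .unit => ⟨()⟩
  | .nat => ⟨(0 : ℕ)⟩
  | .real => ⟨(0 : ℝ)⟩
  | .prod a b => let ⟨x⟩ := a.nonempty_val; let ⟨y⟩ := b.nonempty_val; ⟨(x, y)⟩
  | .sum a _ => let ⟨x⟩ := a.nonempty_val; ⟨Sum.inl x⟩
  | .list _ => ⟨[]⟩

/-- The total correctness judgement: with oracles `A` and `V`, every run of `p` on input `x` halts
within `t` steps with an output satisfying `Q`, and the expected potential `φ` of the output is at
most `r`. -/
def Ensures (A V : List ℕ → ℝ) {a b : Ty} (p : Prog a b) (x : a.val) (t : ℕ) (Q : b.val → Prop)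
    (φ : b.val → ℝ) (r : ℝ) : Prop :=
  ∃ D, Eval A V p x D ∧ Within D t Q φ r

/-- On every run, `p` started on input `x` returns `y` within `t` steps. -/
def Computes (A V : List ℕ → ℝ) {a b : Ty} (p : Prog a b) (x : a.val) (y : b.val) (t : ℕ) : Prop :=
  Ensures A V p x t (· = y) (fun _ => 0) 0

section Ensures

variable {A V : List ℕ → ℝ} {a b c d : Ty} {p : Prog a b} {x : a.val} {t t' : ℕ}
  {Q Q' : b.val → Prop} {φ φ' : b.val → ℝ} {r r' : ℝ} {R : c.val → Prop} {ψ : c.val → ℝ}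

theorem Eval.ensures {D : PMF (b.val × ℕ)} (h : Eval A V p x D)
    (hQ : ∀ o ∈ D.support, o.2 ≤ t ∧ Q o.1) (hr : mean D (fun o => φ o.1) ≤ r) :
    Ensures A V p x t Q φ r :=
  ⟨D, h, h.finite_support, hQ, hr⟩

theorem Ensures.mono (h : Ensures A V p x t Q φ r) (ht : t ≤ t') (hQ : ∀ y, Q y → Q' y)
    (hφ : ∀ y, Q y → φ' y ≤ φ y) (hr : r ≤ r') : Ensures A V p x t' Q' φ' r' :=
  let ⟨D, hD, hfin, hQ₀, hr₀⟩ := h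
  ⟨D, hD, hfin, fun o ho => ⟨(hQ₀ o ho).1.trans ht, hQ _ (hQ₀ o ho).2⟩,
    (mean_mono hfin fun o ho => hφ _ (hQ₀ o ho).2).trans (hr₀.trans hr)⟩

theorem Ensures.mono_time (h : Ensures A V p x t Q φ r) (ht : t ≤ t') : Ensures A V p x t' Q φ r :=
  h.mono ht (fun _ => id) (fun _ _ => le_rfl) le_rfl

theorem Computes.mono_time {y : b.val} (h : Computes A V p x y t) (ht : t ≤ t') :
    Computes A V p x y t' :=
  Ensures.mono_time h ht

theorem Ensures.mul_add (h : Ensures A V p x t Q φ r) {c : ℝ} (hc : 0 ≤ c) (d : ℝ) :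
    Ensures A V p x t Q (fun y => c * φ y + d) (c * r + d) :=
  let ⟨D, hD, hfin, hQ, hr⟩ := h
  ⟨D, hD, hfin, hQ, by rw [mean_mul_add hfin]; gcongr⟩

theorem Ensures.abs_of_sq (hr : 0 ≤ r) (h : Ensures A V p x t Q (fun y => φ y ^ 2) (r ^ 2)) :
    Ensures A V p x t Q (fun y => |φ y|) r :=
  let ⟨D, hD, hfin, hQ, hr₂⟩ := h
  ⟨D, hD, hfin, hQ, le_of_sq_le_sq (α := ℝ) ((sq_mean_le hfin _).trans (by simpa using hr₂)) hr⟩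

theorem Ensures.of_forall_le {d : ℝ} {ψ : b.val → ℝ} (h : Ensures A V p x t Q φ r)
    (hd : ∀ y, Q y → ψ y ≤ d) : Ensures A V p x t Q ψ d := by
  have := h.mul_add le_rfl d
  rw [zero_mul, zero_add] at this
  exact this.mono le_rfl (fun _ => id) (fun y hy => by simpa using hd y hy) le_rfl

theorem Computes.ensures {y : b.val} (h : Computes A V p x y t) (hy : Q y) :
    Ensures A V p x t Q φ (φ y) :=
  (h.of_forall_le fun _ hz => hz ▸ le_rfl).mono le_rfl (fun _ hz => hz ▸ hy) (fun _ _ => le_rfl)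
    le_rfl

theorem Ensures.computes {y : b.val} (h : Ensures A V p x t (· = y) φ r) : Computes A V p x y t :=
  h.of_forall_le fun _ _ => le_rfl

theorem Ensures.comp {q : Prog b c} (hp : Ensures A V p x t Q φ r)
    (hq : ∀ y, Q y → Ensures A V q y t' R ψ (φ y)) :
    Ensures A V (p.comp q) x (t + t' + 1) R ψ r := by
  obtain ⟨D, hD, hDw⟩ := hp
  have : Nonempty (PMF (c.val × ℕ)) := (Ty.prod c .nat).nonempty_val.map PMF.pure
  choose! K hK hKw using hq
  exact ⟨_, .comp p q x D K hD fun o ho => hK o.1 (hDw.2.1 o ho).2,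
    hDw.bind fun y s _ hs hy => (hKw y hy).map fun z u hu hz => ⟨by lia, hz, le_rfl⟩⟩

theorem Ensures.precomp {q : Prog b c} {y : b.val} (hp : Computes A V p x y t)
    (hq : Ensures A V q y t' R ψ r) : Ensures A V (p.comp q) x (t + t' + 1) R ψ r :=
  (hp.ensures rfl (φ := fun _ => r)).comp fun _ h => h ▸ hq

theorem Computes.comp {q : Prog b c} {y : b.val} {z : c.val} (hp : Computes A V p x y t)
    (hq : Computes A V q y z t') : Computes A V (p.comp q) x z (t + t' + 1) :=
  Ensures.precomp hp hq

theorem Ensures.pair {q : Prog a c} {y : b.val} {S : b.val × c.val → Prop}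
    {χ : b.val × c.val → ℝ} (hp : Computes A V p x y t)
    (hq : Ensures A V q x t' (fun z => S (y, z)) (fun z => χ (y, z)) r) :
    Ensures A V (p.pair q) x (t + t' + 1) S χ r := by
  obtain ⟨D, hD, hDw⟩ := hp.ensures rfl (φ := fun _ => r)
  obtain ⟨E, hE, hEw⟩ := hq
  refine ⟨_, .pair p q x D E hD hE, hDw.bind ?_⟩
  rintro y s - hs rfl
  exact hEw.map fun z u hu hz => ⟨by lia, hz, le_rfl⟩

theorem Computes.pair {q : Prog a c} {y : b.val} {z : c.val} (hp : Computes A V p x y t)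
    (hq : Computes A V q x z t') : Computes A V (p.pair q) x (y, z) (t + t' + 1) :=
  Ensures.pair hp (hq.mono le_rfl (fun _ h => congrArg (Prod.mk y) h) (fun _ _ => le_rfl) le_rfl)

theorem Ensures.caseInr {p : Prog (.prod a c) d} {q : Prog (.prod b c) d} {u : b.val} {w : c.val}
    {R : d.val → Prop} {ψ : d.val → ℝ} (hq : Ensures A V q (u, w) t R ψ r) :
    Ensures A V (.case p q) (Sum.inr u, w) (t + 1) R ψ r :=
  let ⟨D, hD, hDw⟩ := hq
  ⟨_, .caseInr p q u w D hD, hDw.map fun _ _ hs hz => ⟨Nat.succ_le_succ hs, hz, le_rfl⟩⟩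

theorem Ensures.loop {p : Prog a (.sum a b)} {P : a.val → Prop} {χ : a.val → ℝ}
    (hp : Ensures A V p x t (Sum.elim P Q) (Sum.elim χ φ) r)
    (hloop : ∀ y, P y → Ensures A V (.loop p) y t' Q φ (χ y)) :
    Ensures A V (.loop p) x (t + t' + 1) Q φ r := by
  obtain ⟨D, hD, hDw⟩ := hp
  have : Nonempty (PMF (b.val × ℕ)) := (Ty.prod b .nat).nonempty_val.map PMF.pure
  choose! K hK hKw using hloop
  refine ⟨_, .loop p x D K hD fun y s hy => hK y (hDw.2.1 _ hy).2, hDw.bind ?_⟩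
  rintro (y | z) s - hs hy
  · exact (hKw y hy).map fun z u hu hz => ⟨by lia, hz, le_rfl⟩
  · exact .pure (by lia) hy le_rfl

theorem Ensures.flip {ρ : ℝ} (hρ : ρ ∈ Set.Icc 0 1) {φ : Unit ⊕ Unit → ℝ} :
    Ensures A V .flip ρ 1 (fun _ => True) φ
      (ρ * φ (Sum.inl ()) + (1 - ρ) * φ (Sum.inr ())) := by
  refine (Eval.flip ρ).ensures ?_ ?_
  · simp
  · rw [mean_map _ (Set.toFinite _), mean_coin hρ]

end Ensures

section Run

variable {A V : List ℕ → ℝ}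

/-- The output and the number of steps of a deterministic run, or `none` if the run reaches a coin
toss or a loop.  It lets the kernel execute straight-line programs. -/
noncomputable def Prog.run (A V : List ℕ → ℝ) :
    {a b : Ty} → Prog a b → a.val → Option (b.val × ℕ)
  | _, _, .prim o, x => some (o.eval x, 1)
  | _, _, .flip, _ => none
  | _, _, .askSystem, l => some (A l, 1)
  | _, _, .askValue, l => some (V l, 1)
  | _, _, .comp p q, x => (p.run A V x).bind fun y =>
      (q.run A V y.1).map fun z => (z.1, y.2 + z.2 + 1)
  | _, _, .pair p q, x => (p.run A V x).bind fun y =>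
      (q.run A V x).map fun z => ((y.1, z.1), y.2 + z.2 + 1)
  | _, _, .case p _, (Sum.inl u, w) => (p.run A V (u, w)).map fun z => (z.1, z.2 + 1)
  | _, _, .case _ q, (Sum.inr u, w) => (q.run A V (u, w)).map fun z => (z.1, z.2 + 1)
  | _, _, .loop _, _ => none

theorem Eval.of_run {a b : Ty} {p : Prog a b} {x : a.val} {o : b.val × ℕ}
    (h : p.run A V x = some o) : Eval A V p x (PMF.pure o) := by
  induction p with
  | prim f => cases h; exact .prim f x
  | flip | loop => cases h
  | askSystem => cases h; exact .askSystem x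
  | askValue => cases h; exact .askValue x
  | comp p q ihp ihq =>
    simp only [Prog.run, Option.bind_eq_some_iff, Option.map_eq_some_iff] at h
    obtain ⟨y, hy, z, hz, rfl⟩ := h
    convert Eval.comp p q x _ (fun _ => PMF.pure z) (ihp hy) ?_
    · rw [PMF.pure_bind, PMF.pure_map]
    · simpa using ihq hz
  | pair p q ihp ihq =>
    simp only [Prog.run, Option.bind_eq_some_iff, Option.map_eq_some_iff] at h
    obtain ⟨y, hy, z, hz, rfl⟩ := h
    convert Eval.pair p q x _ _ (ihp hy) (ihq hz)
    rw [PMF.pure_bind, PMF.pure_map]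
  | case p q ihp ihq =>
    obtain ⟨u | u, w⟩ := x <;> obtain ⟨z, hz, rfl⟩ := Option.map_eq_some_iff.1 h
    · convert Eval.caseInl p q u w _ (ihp hz)
      rw [PMF.pure_map]
    · convert Eval.caseInr p q u w _ (ihq hz)
      rw [PMF.pure_map]

theorem Computes.of_run {a b : Ty} {p : Prog a b} {x : a.val} {y : b.val} {s t : ℕ}
    (h : p.run A V x = some (y, s)) (hs : s ≤ t) : Computes A V p x y t :=
  (Eval.of_run h).ensures (by simpa using hs) (mean_pure _ _).le

theorem Ensures.comp_run {a b c : Ty} {p : Prog a b} {q : Prog b c} {x : a.val} {s t : ℕ}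
    {k : b.val → c.val} {R : c.val → Prop} {ψ : c.val → ℝ} {r : ℝ}
    (hp : Ensures A V p x t (fun y => R (k y)) (fun y => ψ (k y)) r)
    (hq : ∀ y, q.run A V y = some (k y, s)) : Ensures A V (p.comp q) x (t + s + 1) R ψ r :=
  hp.comp fun y hy => (Computes.of_run (hq y) le_rfl).ensures hy

end Run

/-! ## Program constructions -/

local notation:65 p:65 "⨾" q:66 => Prog.comp p q
local notation:67 p:68 "△" q:67 => Prog.pair p q

/-- The first projection, as a program. -/
abbrev π₁ {a b : Ty} : Prog (.prod a b) a := .prim .fst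

/-- The second projection, as a program. -/
abbrev π₂ {a b : Ty} : Prog (.prod a b) b := .prim .snd

section Constructions

variable {A V : List ℕ → ℝ} {a c s : Ty}

/-- One round of `forDown`. -/
def forDownStep (body : Prog (.prod .nat (.prod c s)) s) :
    Prog (.prod .nat (.prod c s)) (.sum (.prod .nat (.prod c s)) s) :=
  (π₁ ⨾ .prim .natPred) △ π₂ ⨾
    .case (π₂ ⨾ π₂ ⨾ .prim .inr) (π₁ △ (π₂ ⨾ π₁) △ body ⨾ .prim .inl)

/-- Run the body for the indices `n - 1, …, 0`, on input `(n, (w, y))` with `w` a constant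
environment and `y` the initial state. -/
def forDown (body : Prog (.prod .nat (.prod c s)) s) : Prog (.prod .nat (.prod c s)) s :=
  .loop (forDownStep body)

theorem Ensures.forDown {body : Prog (.prod .nat (.prod c s)) s} {w : c.val} {n t : ℕ}
    (Inv : ℕ → s.val → Prop) (Φ : ℕ → s.val → ℝ)
    (hbody : ∀ k < n, ∀ y, Inv (k + 1) y →
      Ensures A V body (k, (w, y)) t (Inv k) (Φ k) (Φ (k + 1) y))
    {y : s.val} (hy : Inv n y) :
    Ensures A V (forDown body) (n, (w, y)) (n * (t + 20) + 20) (Inv 0) (Φ 0) (Φ n y) := by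
  induction n generalizing y with
  | zero =>
    have hexit : Computes A V (forDownStep body) ((0 : ℕ), (w, y)) (Sum.inr y) 19 :=
      .of_run rfl (by norm_num)
    refine ((hexit.ensures (Q := Sum.elim (fun _ => False) (Inv 0)) hy
      (φ := Sum.elim (fun _ => 0) (Φ 0))).loop (t' := 0) ?_).mono_time (by lia)
    simp
  | succ n ih =>
    have hpair : Ensures A V (π₁ △ (π₂ ⨾ π₁) △ body) (n, (w, y)) (t + 6)
        (fun z => ∃ z', Inv n z' ∧ z = (n, (w, z'))) (fun z => Φ n z.2.2) (Φ (n + 1) y) := by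
      refine (Ensures.pair (.of_run rfl le_rfl) (Ensures.pair
        (.of_run rfl le_rfl) ?_)).mono_time (t := 1 + (3 + t + 1) + 1) (by lia)
      exact (hbody n n.lt_succ_self y hy).mono le_rfl (fun z hz => ⟨z, hz, rfl⟩)
        (fun _ _ => le_rfl) le_rfl
    have hstep : Ensures A V (forDownStep body) (n + 1, (w, y)) (t + 18)
        (Sum.elim (fun z => ∃ z', Inv n z' ∧ z = (n, (w, z'))) (Inv 0))
        (Sum.elim (fun z => Φ n z.2.2) (Φ 0)) (Φ (n + 1) y) :=
      (Ensures.precomp (y := (Sum.inr n, (w, y))) (t := 5) (.of_run rfl (by norm_num))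
        (hpair.comp_run (s := 1) fun _ => rfl).caseInr).mono_time (by lia)
    refine (hstep.loop (t' := n * (t + 20) + 20) ?_).mono_time (by lia)
    rintro _ ⟨z, hz, rfl⟩
    exact ih (fun k hk => hbody k (hk.trans n.lt_succ_self)) hz

theorem Computes.forDown {body : Prog (.prod .nat (.prod c s)) s} {w : c.val} {n t : ℕ}
    {y z : s.val} (g : ℕ → s.val) (hn : g n = y) (h0 : g 0 = z)
    (hbody : ∀ k < n, Computes A V body (k, (w, g (k + 1))) (g k) t) :
    Computes A V (forDown body) (n, (w, y)) z (n * (t + 20) + 20) := by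
  subst hn h0
  exact Ensures.forDown (fun k y => y = g k) (fun _ _ => 0) (fun k hk _ hy => hy ▸ hbody k hk) rfl

/-- The square of a natural number, by repeated addition. -/
def natSq : Prog .nat .nat :=
  .prim .id △ .prim .id △ .prim .natZero ⨾ forDown (π₂ ⨾ .prim .natAdd)

theorem Computes.natSq (m : ℕ) : Computes A V natSq m (m ^ 2) (m * 23 + 26) := by
  refine (Computes.comp (y := (m, (m, 0))) (t := 5) (.of_run rfl (by norm_num))
    (.forDown (t := 3) (fun k => (m - k) * m) (by simp) (by simp [sq]) fun k hk => ?_)).mono_time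
    (by lia)
  have hstep : (m - k) * m = m + (m - (k + 1)) * m := by
    rw [show m - k = 1 + (m - (k + 1)) by lia]
    ring
  rw [hstep]
  exact .of_run rfl le_rfl

/-- The tail of a list. -/
def listTail : Prog (.list a) (.list a) :=
  .prim .uncons △ .prim .unit ⨾ .case (.prim .nil) (π₁ ⨾ π₂)

theorem Computes.listTail (l : List a.val) : Computes A V (listTail (a := a)) l l.tail 8 := by
  cases l
  · exact .of_run rfl (by norm_num)
  · exact .of_run rfl (by norm_num)

/-- The head of a list of reals, or zero. -/
def realHead : Prog (.list .real) .real :=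
  .prim .uncons △ .prim .unit ⨾ .case (.prim .natZero ⨾ .prim .natCast) (π₁ ⨾ π₁)

theorem Computes.realHead (l : List ℝ) : Computes A V realHead l (l.headD 0) 8 := by
  cases l with
  | nil => exact Nat.cast_zero (R := ℝ) ▸ .of_run rfl (by norm_num)
  | cons => exact .of_run rfl (by norm_num)

/-- The entry of a list of reals at a given position, or zero. -/
def realGet : Prog (.prod .nat (.list .real)) .real :=
  π₁ △ .prim .unit △ π₂ ⨾ forDown (π₂ ⨾ π₂ ⨾ listTail) ⨾ realHead

theorem Computes.realGet (i : ℕ) (l : List ℝ) :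
    Computes A V realGet (i, l) (l.getD i 0) (i * 32 + 40) := by
  have hhead : (l.drop i).headD 0 = l.getD i 0 := by
    rw [List.headD_eq_head?_getD, List.head?_drop, List.getD_eq_getElem?_getD]
  have hdrop : Computes A V (SubmodMax.forDown (c := .unit) (s := .list .real)
      (π₂ ⨾ π₂ ⨾ SubmodMax.listTail)) (i, ((), l)) (l.drop i) (i * 32 + 20) := by
    refine .forDown (fun k => l.drop (i - k)) (by simp) rfl fun k hk => ?_
    rw [show i - k = i - (k + 1) + 1 by lia, ← List.tail_drop]
    exact .comp (.of_run rfl le_rfl) (.listTail _)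
  exact hhead ▸ ((Computes.of_run rfl le_rfl).comp hdrop |>.comp (.realHead _)).mono_time (by lia)

/-- One round of `tabulate`. -/
def tabulateStep (p : Prog (.prod .nat c) .real) :
    Prog (.prod .nat (.prod c (.list .real))) (.list .real) :=
  (π₂ ⨾ π₂) △ (π₁ △ (π₂ ⨾ π₁) ⨾ p) ⨾ (π₂ △ π₁ ⨾ .prim .cons)

/-- The list of the outputs of a program at the indices `0, …, n - 1`, on input `(n, w)`. -/
def tabulate (p : Prog (.prod .nat c) .real) : Prog (.prod .nat c) (.list .real) :=
  π₁ △ π₂ △ .prim .nil ⨾ forDown (tabulateStep p)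

theorem Ensures.tabulateStep {p : Prog (.prod .nat c) .real} {k t : ℕ} {w : c.val} {l : List ℝ}
    {Q : List ℝ → Prop} {φ : List ℝ → ℝ} {r : ℝ}
    (hp : Ensures A V p (k, w) t (fun v => Q (v :: l)) (fun v => φ (v :: l)) r) :
    Ensures A V (tabulateStep p) (k, (w, l)) (t + 20) Q φ r := by
  have hval : Ensures A V (a := .prod .nat (.prod c (.list .real))) (π₁ △ (π₂ ⨾ π₁) ⨾ p)
      (k, (w, l)) (t + 6) (fun v => Q (v :: l)) (fun v => φ (v :: l)) r :=
    (Ensures.precomp (t := 5) (.of_run rfl le_rfl) hp).mono_time (by lia)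
  exact .mono_time (t := 3 + (t + 6) + 1 + 5 + 1) (.comp_run (k := fun z : List ℝ × ℝ => z.2 :: z.1)
    (.pair (.of_run rfl le_rfl) hval) fun _ => rfl) (by lia)

theorem Ensures.tabulate {p : Prog (.prod .nat c) .real} {w : c.val} {n t : ℕ}
    {Q : Fin n → ℝ → Prop} {φ : Fin n → ℝ → ℝ} {r : Fin n → ℝ}
    (hp : ∀ i : Fin n, Ensures A V p ((i : ℕ), w) t (Q i) (φ i) (r i)) :
    Ensures A V (tabulate p) (n, w) (n * (t + 40) + 26)
      (fun l => l.length = n ∧ ∀ i : Fin n, Q i (l.getD i 0))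
      (fun l => ∑ i : Fin n, φ i (l.getD i 0)) (∑ i, r i) := by
  let Inv (k : ℕ) (l : List ℝ) := l.length + k = n ∧ ∀ i : Fin n, k ≤ i → Q i (l.getD (i - k) 0)
  let term (k : ℕ) (l : List ℝ) (i : Fin n) := if i < k then r i else φ i (l.getD (i - k) 0)
  have hstep : ∀ k < n, ∀ l, Inv (k + 1) l → Ensures A V (SubmodMax.tabulateStep p) (k, (w, l))
      (t + 20) (Inv k) (fun l => ∑ i, term k l i) (∑ i, term (k + 1) l i) := fun k hk l hl => by
    have hval := (hp ⟨k, hk⟩).mul_add zero_le_one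
      (∑ i ∈ Finset.univ.erase ⟨k, hk⟩, term (k + 1) l i)
    have hsucc (v : ℝ) (i : Fin n) (hi : k < i) :
        (v :: l).getD (i - k) 0 = l.getD (i - (k + 1)) 0 := by
      rw [show (i : ℕ) - k = i - (k + 1) + 1 by lia, List.getD_cons_succ]
    refine .tabulateStep (hval.mono le_rfl (fun v hv => ⟨?_, fun i hi => ?_⟩)
      (fun v _ => ?_) ?_)
    · rw [List.length_cons, add_assoc, add_comm 1, hl.1]
    · rcases hi.eq_or_lt with rfl | hi
      · simpa using hv
      · exact (hsucc v i hi).symm ▸ hl.2 i hi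
    · rw [← Finset.add_sum_erase _ _ (Finset.mem_univ ⟨k, hk⟩), one_mul]
      refine add_le_add (by simp [term]) (Finset.sum_le_sum fun i hi => le_of_eq ?_)
      have hik : (i : ℕ) ≠ k := fun h => Finset.ne_of_mem_erase hi (Fin.ext h)
      rcases lt_or_gt_of_ne hik with hlt | hgt
      · simp only [term, hlt, hlt.trans k.lt_succ_self, if_true]
      · simp only [term, hgt.not_gt, (Nat.succ_le_of_lt hgt).not_gt, if_false, hsucc v i hgt]
    · rw [← Finset.add_sum_erase _ (term (k + 1) l) (Finset.mem_univ ⟨k, hk⟩), one_mul]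
      simp [term]
  have hloop := Ensures.forDown (s := .list .real) Inv (fun k l => ∑ i, term k l i) hstep
    (y := []) ⟨by simp, by lia⟩
  refine (Ensures.precomp (.of_run rfl le_rfl) hloop).mono (by lia) ?_ ?_ ?_
  · simp [Inv]
  · simp [term]
  · simp [term]

theorem getD_ofFn {β : Type*} {n : ℕ} (x : Fin n → β) (i : Fin n) {d : β} :
    (List.ofFn x).getD i d = x i := by
  rw [List.getD_eq_getElem _ _ (by simp)]
  simp

theorem ofFn_getD {β : Type*} {n : ℕ} {l : List β} {d : β} (hl : l.length = n) :
    List.ofFn (fun i : Fin n => l.getD i d) = l := by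
  subst hl
  exact List.ext_getElem (by simp) (by simp)

theorem Computes.tabulate {p : Prog (.prod .nat c) .real} {w : c.val} {n t : ℕ} {x : Fin n → ℝ}
    (hp : ∀ i : Fin n, Computes A V p ((i : ℕ), w) (x i) t) :
    Computes A V (tabulate p) (n, w) (List.ofFn x) (n * (t + 40) + 26) := by
  refine ((Ensures.tabulate hp).mono le_rfl (fun l hl => ?_) (by simp) (by simp)).computes
    (φ := fun _ => 0) (r := 0)
  rw [← ofFn_getD hl.1]
  exact congrArg List.ofFn (funext hl.2)

end Constructions

/-! ## Sampling and gradient estimation -/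

section Gradient

variable {A : List ℕ → ℝ} {a : Ty} {n : ℕ}

theorem toSet_nil : toSet n [] = ∅ := by simp [toSet]

theorem toSet_cons (i : Fin n) (l : List ℕ) : toSet n (i :: l) = insert i (toSet n l) := by
  ext j
  simp [toSet, Fin.ext_iff]

/-- One round of `sampleSet`. -/
def sampleStep : Prog (.prod .nat (.prod (.list .real) (.list .nat))) (.list .nat) :=
  .prim .id △ (π₁ △ (π₂ ⨾ π₁) ⨾ realGet ⨾ .flip) ⨾ (π₂ △ π₁ ⨾
    .case (π₂ ⨾ π₁ △ (π₂ ⨾ π₂) ⨾ .prim .cons) (π₂ ⨾ π₂ ⨾ π₂))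

/-- A random set that contains the elements independently, with the given probabilities, on input
`(n, x)`. -/
def sampleSet : Prog (.prod .nat (.list .real)) (.list .nat) :=
  π₁ △ π₂ △ .prim .nil ⨾ forDown sampleStep

theorem Ensures.sampleStep {V : List ℕ → ℝ} {k : ℕ} {xs : List ℝ} {R : List ℕ}
    {φ : List ℕ → ℝ}
    (hx : xs.getD k 0 ∈ Set.Icc (0 : ℝ) 1) :
    Ensures A V sampleStep (k, (xs, R)) (k * 32 + 80) (fun _ => True) φ
      (xs.getD k 0 * φ (k :: R) + (1 - xs.getD k 0) * φ R) := by
  let out (z : (ℕ × List ℝ × List ℕ) × (Unit ⊕ Unit)) : List ℕ :=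
    Sum.elim (fun _ => z.1.1 :: z.1.2.2) (fun _ => z.1.2.2) z.2
  have hcoin : Ensures A V (a := .prod .nat (.prod (.list .real) (.list .nat)))
      (π₁ △ (π₂ ⨾ π₁) ⨾ realGet ⨾ .flip) (k, (xs, R)) (k * 32 + 48) (fun _ => True)
      (fun o => φ (out ((k, (xs, R)), o)))
      (xs.getD k 0 * φ (k :: R) + (1 - xs.getD k 0) * φ R) :=
    .mono_time (.precomp (.comp (t := 5) (.of_run rfl le_rfl) (.realGet k xs)) (.flip hx)) (by lia)
  have hcase (o : Unit ⊕ Unit) : Computes A V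
      (π₂ △ π₁ ⨾ .case (π₂ ⨾ π₁ △ (π₂ ⨾ π₂) ⨾ .prim .cons) (π₂ ⨾ π₂ ⨾ π₂) :
        Prog (.prod (.prod .nat (.prod (.list .real) (.list .nat))) .bool) (.list .nat))
      ((k, (xs, R)), o) (out ((k, (xs, R)), o)) 15 := by
    rcases o with _ | _
    · exact .of_run rfl (by norm_num)
    · exact .of_run rfl (by norm_num)
  refine .mono_time (t := 1 + (k * 32 + 48) + 1 + 15 + 1) (.comp (.pair
    (S := fun z => z.1 = (k, (xs, R))) (χ := fun z => φ (out z))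
    (.of_run rfl le_rfl) (hcoin.mono le_rfl (fun _ _ => rfl) (fun _ _ => le_rfl) le_rfl)) ?_)
    (by lia)
  rintro ⟨_, o⟩ rfl
  exact (hcase o).ensures trivial

theorem Ensures.sampleSet {V : List ℕ → ℝ} {x : Fin n → ℝ} (hx : ∀ i, x i ∈ Set.Icc 0 1)
    (g : Finset (Fin n) → ℝ) :
    Ensures A V sampleSet (n, List.ofFn x) (n * (n * 32 + 100) + 26) (fun _ => True)
      (fun R => g (toSet n R)) (multilinear x Finset.univ g ∅) := by
  let below (k : ℕ) : Finset (Fin n) := {i | (i : ℕ) < k}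
  have hstep : ∀ k < n, ∀ R, True → Ensures A V SubmodMax.sampleStep (k, (List.ofFn x, R))
      (n * 32 + 80) (fun _ => True) (fun R => multilinear x (below k) g (toSet n R))
      (multilinear x (below (k + 1)) g (toSet n R)) := fun k hk R _ => by
    have hbelow : below (k + 1) = insert ⟨k, hk⟩ (below k) := by
      ext i
      simpa [below, Fin.ext_iff] using Nat.le_iff_lt_or_eq.trans or_comm
    have hget : (List.ofFn x).getD k 0 = x ⟨k, hk⟩ := getD_ofFn x ⟨k, hk⟩
    refine (Ensures.sampleStep (hget ▸ hx _)).mono (by lia) (fun _ => id) (fun _ _ => le_rfl) ?_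
    rw [hget, hbelow, multilinear_insert_apply _ (by simp [below]), ← toSet_cons, add_comm]
  have hloop := Ensures.forDown (s := .list .nat) (fun _ _ => True)
    (fun k R => multilinear x (below k) g (toSet n R)) hstep (y := []) trivial
  refine (Ensures.precomp (t := 5) (.of_run rfl le_rfl) hloop).mono (by lia) (fun _ => id) ?_ ?_
  · simp [below]
  · simp [below, toSet_nil]

/-- A sample of the marginal of `j` at a random set, on input `(j, (n, x))`. -/
def sampleMarginal : Prog (.prod .nat (.prod .nat (.list .real))) .real :=
  π₁ △ (π₂ ⨾ sampleSet) ⨾ ((.prim .cons ⨾ .askValue) △ (π₂ ⨾ .askValue) ⨾ .prim .realSub)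

theorem Ensures.sampleMarginal {f : Finset (Fin n) → ℝ} {x : Fin n → ℝ}
    (hx : ∀ i, x i ∈ Set.Icc 0 1) (j : Fin n) (φ : ℝ → ℝ) :
    Ensures A (valueOracle f) sampleMarginal ((j : ℕ), (n, List.ofFn x))
      (n * (n * 32 + 100) + 40) (fun _ => True) φ
      (multilinear x Finset.univ (fun R => φ (marginal j f R)) ∅) := by
  have hsample : Ensures A (valueOracle f) (a := .prod .nat (.prod .nat (.list .real)))
      (π₁ △ (π₂ ⨾ SubmodMax.sampleSet)) ((j : ℕ), (n, List.ofFn x)) (n * (n * 32 + 100) + 30)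
      (fun _ => True) (fun z => φ (valueOracle f (z.1 :: z.2) - valueOracle f z.2))
      (multilinear x Finset.univ (fun R => φ (marginal j f R)) ∅) := by
    refine (Ensures.pair (t' := n * (n * 32 + 100) + 28) (.of_run rfl le_rfl)
      (.mono (.precomp (.of_run rfl le_rfl) (.sampleSet hx _)) (by lia) (fun _ => id)
        (fun R _ => ?_) le_rfl)).mono_time (by lia)
    exact le_of_eq (congrArg (fun S => φ (f S - f (toSet n R))) (toSet_cons j R))
  exact hsample.comp_run (s := 9) (fun _ => rfl)
    (k := fun z : ℕ × List ℕ => valueOracle f (z.1 :: z.2) - valueOracle f z.2)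

/-- One round of `average`. -/
def averageStep (p : Prog a .real) : Prog (.prod .nat (.prod a .real)) .real :=
  (π₂ ⨾ π₂) △ (π₂ ⨾ π₁ ⨾ p) ⨾ .prim .realAdd

/-- The average output of `N` independent runs of a program, on input `(N, w)`. -/
def average (p : Prog a .real) : Prog (.prod .nat a) .real :=
  (π₁ ⨾ .prim .natCast) △ (π₁ △ π₂ △ (.prim .natZero ⨾ .prim .natCast) ⨾
    forDown (averageStep p)) ⨾ (π₂ △ π₁ ⨾ .prim .realDiv)

theorem Ensures.averageStep {V : List ℕ → ℝ} {p : Prog a .real} {w : a.val} {k t : ℕ} {y r : ℝ}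
    {φ : ℝ → ℝ} (hp : Ensures A V p w t (fun _ => True) (fun v => φ (y + v)) r) :
    Ensures A V (averageStep p) (k, (w, y)) (t + 10) (fun _ => True) φ r := by
  have hterm : Ensures A V (a := .prod .nat (.prod a .real)) (π₂ ⨾ π₁ ⨾ p) (k, (w, y)) (t + 4)
      (fun _ => True) (fun v => φ (y + v)) r :=
    .mono_time (.precomp (t := 3) (.of_run rfl le_rfl) hp) (by lia)
  exact .mono_time (.comp_run (s := 1) (t := 3 + (t + 4) + 1) (k := fun z : ℝ × ℝ => z.1 + z.2)
    (.pair (.of_run rfl le_rfl) hterm) fun _ => rfl) (by lia)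

theorem Ensures.average {V : List ℕ → ℝ} {p : Prog a .real} {w : a.val} {N t : ℕ} {m b : ℝ}
    (hp : ∀ c, Ensures A V p w t (fun _ => True) (fun y => (c + (y - m)) ^ 2) (c ^ 2 + b ^ 2))
    (hN : 0 < N) (hb : 0 ≤ b) :
    Ensures A V (average p) (N, w) (N * (t + 30) + 50) (fun _ => True) (fun y => |y - m|)
      (b / √N) := by
  have hstep : ∀ k < N, ∀ y, True → Ensures A V (SubmodMax.averageStep p) (k, (w, y)) (t + 10)
      (fun _ => True) (fun y => (y - (N - k) * m) ^ 2 + k * b ^ 2)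
      ((y - (N - (k + 1 : ℕ)) * m) ^ 2 + (k + 1 : ℕ) * b ^ 2) := fun k _ y _ => by
    have h := (hp (y - (N - (k + 1 : ℕ)) * m)).mul_add zero_le_one (k * b ^ 2)
    refine .averageStep (h.mono le_rfl (fun _ => id) (fun v _ => le_of_eq ?_) (le_of_eq ?_))
    · push_cast
      ring
    · push_cast
      ring
  have hloop := Ensures.forDown (s := .real) (fun _ _ => True)
    (fun k y => (y - (N - k) * m) ^ 2 + k * b ^ 2) hstep (y := ((0 : ℕ) : ℝ)) trivial
  have hsum : Ensures A V (a := .prod .nat a) (π₁ △ π₂ △ (.prim .natZero ⨾ .prim .natCast) ⨾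
      SubmodMax.forDown (SubmodMax.averageStep p)) (N, w) (N * (t + 30) + 30) (fun _ => True)
      (fun y => (y / N - m) ^ 2) ((b / √N) ^ 2) := by
    have hinit : Computes A V (a := .prod .nat a)
        (π₁ △ π₂ △ (.prim .natZero ⨾ .prim .natCast)) (N, w) (N, (w, ((0 : ℕ) : ℝ))) 7 :=
      .of_run rfl le_rfl
    have hN' : (N : ℝ) ≠ 0 := by positivity
    have h := (Ensures.precomp hinit hloop).mul_add
      (c := 1 / (N : ℝ) ^ 2) (by positivity) 0
    refine h.mono (by lia) (fun _ => id) (fun y _ => le_of_eq ?_) (le_of_eq ?_)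
    · push_cast
      field_simp
      ring
    · rw [div_pow, Real.sq_sqrt N.cast_nonneg]
      field_simp
      simp
  exact .abs_of_sq (by positivity) <| .mono_time (.comp_run (s := 5)
    (t := 3 + (N * (t + 30) + 30) + 1) (k := fun z : ℝ × ℝ => z.2 / z.1)
    (.pair (.of_run rfl le_rfl) hsum) fun _ => rfl) (by lia)

/-- The average of `(n + 1) ^ 4` samples of the marginal of `j`, on input `(j, (n, x))`. -/
def estimate : Prog (.prod .nat (.prod .nat (.list .real))) .real :=
  (π₂ ⨾ π₁ ⨾ .prim .natSucc ⨾ natSq ⨾ natSq) △ .prim .id ⨾ average sampleMarginal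

/-- A bound on the running time of `estimate`. -/
def estimateTime (n : ℕ) : ℕ :=
  (n + 1) ^ 4 * (n * (n * 32 + 100) + 70) + (n + 1) ^ 2 * 23 + (n + 1) * 23 + 120

theorem Ensures.estimate {f : Finset (Fin n) → ℝ} {x : Fin n → ℝ} (hx : ∀ i, x i ∈ Set.Icc 0 1)
    {j : Fin n} {b : ℝ} (hb : ∀ S, |marginal j f S| ≤ b) :
    Ensures A (valueOracle f) estimate ((j : ℕ), (n, List.ofFn x)) (estimateTime n)
      (fun _ => True) (fun y => |y - multilinear x Finset.univ (marginal j f) ∅|)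
      (b / (n + 1) ^ 2) := by
  have hcount : Computes A (valueOracle f) (a := .prod .nat (.prod .nat (.list .real)))
      (π₂ ⨾ π₁ ⨾ .prim .natSucc ⨾ SubmodMax.natSq ⨾ SubmodMax.natSq)
      ((j : ℕ), (n, List.ofFn x)) (((n + 1) ^ 2) ^ 2) ((n + 1) ^ 2 * 23 + (n + 1) * 23 + 59) :=
    .mono_time (.comp (.comp (y := n + 1) (t := 5) (.of_run rfl le_rfl) (.natSq _)) (.natSq _))
      (by lia)
  have havg : Ensures A (valueOracle f) (SubmodMax.average SubmodMax.sampleMarginal)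
      (((n + 1) ^ 2) ^ 2, ((j : ℕ), (n, List.ofFn x)))
      (((n + 1) ^ 2) ^ 2 * (n * (n * 32 + 100) + 40 + 30) + 50) (fun _ => True)
      (fun y => |y - multilinear x Finset.univ (marginal j f) ∅|)
      (b / √(((n + 1) ^ 2) ^ 2 : ℕ)) :=
    .average (fun c => (Ensures.sampleMarginal hx j _).mono le_rfl (fun _ => id)
      (fun _ _ => le_rfl) (multilinear_sq_sub_le hx _ _ hb c)) (by positivity)
      ((abs_nonneg _).trans (hb ∅))
  have hsqrt : √(((n + 1) ^ 2) ^ 2 : ℕ) = ((n : ℝ) + 1) ^ 2 := by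
    push_cast
    exact Real.sqrt_sq (by positivity)
  rw [hsqrt] at havg
  refine .mono_time (.precomp (.pair (t' := 1) hcount (.of_run rfl le_rfl)) havg) ?_
  rw [estimateTime]
  lia

/-- An estimate of the gradient of the multilinear extension at `x`, on input `(n, x)`. -/
def gradient : Prog (.prod .nat (.list .real)) (.list .real) :=
  π₁ △ .prim .id ⨾ tabulate estimate

/-- A bound on the expected `ℓ¹` error of `gradient` on the coordinates in `J`. -/
noncomputable def gradientError (f : Finset (Fin n) → ℝ) (J : Finset (Fin n)) : ℝ :=
  ∑ j ∈ J, f {j} / (n + 1) ^ 2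

theorem Ensures.gradient {f : Finset (Fin n) → ℝ} (hf : Submodular f) (hm : Monotone f)
    (h0 : ∀ S, 0 ≤ f S) {x : Fin n → ℝ} (hx : ∀ i, x i ∈ Set.Icc 0 1) (J : Finset (Fin n)) :
    Ensures A (valueOracle f) gradient (n, List.ofFn x) (n * (estimateTime n + 40) + 30)
      (fun l => l.length = n)
      (fun l => ∑ j ∈ J, |l.getD j 0 - multilinear x Finset.univ (marginal j f) ∅|)
      (gradientError f J) := by
  have hbound (j : Fin n) (S : Finset (Fin n)) : |marginal j f S| ≤ f {j} := by
    rw [abs_of_nonneg (marginal_nonneg hm j S)]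
    exact hf.marginal_le_singleton h0 j S
  have htab := Ensures.tabulate fun j : Fin n => (Ensures.estimate (A := A) hx (hbound j)).mul_add
    (c := if j ∈ J then 1 else 0) (by positivity) 0
  refine .mono (.precomp (.of_run rfl le_rfl) htab) (by lia) (fun _ hl => hl.1)
    (fun l _ => le_of_eq ?_) (le_of_eq ?_)
  · simp
  · simp [gradientError]

end Gradient

/-! ## The continuous greedy algorithm -/

section Greedy

open scoped Pointwise

variable {A V : List ℕ → ℝ} {n t : ℕ} {f : Finset (Fin n) → ℝ} {K : Set (Fin n → ℝ)}
  {J O : Finset (Fin n)} {p : Prog (.prod .pres (.list .real)) (.list .real)} {w : Ty.pres.val}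

/-- One entry of `addScaled`. -/
def addScaledEntry : Prog (.prod .nat (.prod .nat (.prod (.list .real) (.list .real)))) .real :=
  (π₁ △ (π₂ ⨾ π₂ ⨾ π₁) ⨾ realGet) △ ((π₁ △ (π₂ ⨾ π₂ ⨾ π₂) ⨾ realGet) △
    (π₂ ⨾ π₁ ⨾ .prim .natSucc ⨾ .prim .natCast ⨾ .prim .id △ .prim .id ⨾ .prim .realMul) ⨾
      .prim .realDiv) ⨾ .prim .realAdd

/-- The vector `x + (n + 1)⁻² • v`, on input `(n, (x, v))`. -/
def addScaled : Prog (.prod .nat (.prod (.list .real) (.list .real))) (.list .real) :=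
  π₁ △ .prim .id ⨾ tabulate addScaledEntry

theorem Computes.addScaledEntry (i : Fin n) (x v : Fin n → ℝ) :
    Computes A V addScaledEntry ((i : ℕ), (n, (List.ofFn x, List.ofFn v)))
      (x i + v i / ((n + 1 : ℕ) * (n + 1 : ℕ))) (n * 64 + 120) := by
  have hx : Computes A V (a := .prod .nat (.prod .nat (.prod (.list .real) (.list .real))))
      (π₁ △ (π₂ ⨾ π₂ ⨾ π₁) ⨾ SubmodMax.realGet) ((i : ℕ), (n, (List.ofFn x, List.ofFn v)))
      (x i) (n * 32 + 48) :=
    getD_ofFn x i ▸ .mono_time (.comp (t := 7) (y := ((i : ℕ), List.ofFn x)) (.of_run rfl le_rfl)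
      (.realGet _ _)) (by lia)
  have hv : Computes A V (a := .prod .nat (.prod .nat (.prod (.list .real) (.list .real))))
      (π₁ △ (π₂ ⨾ π₂ ⨾ π₂) ⨾ SubmodMax.realGet) ((i : ℕ), (n, (List.ofFn x, List.ofFn v)))
      (v i) (n * 32 + 48) :=
    getD_ofFn v i ▸ .mono_time (.comp (t := 7) (y := ((i : ℕ), List.ofFn v)) (.of_run rfl le_rfl)
      (.realGet _ _)) (by lia)
  have hscale : Computes A V (a := .prod .nat (.prod .nat (.prod (.list .real) (.list .real))))
      (π₂ ⨾ π₁ ⨾ .prim .natSucc ⨾ .prim .natCast ⨾ .prim .id △ .prim .id ⨾ .prim .realMul)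
      ((i : ℕ), (n, (List.ofFn x, List.ofFn v))) ((n + 1 : ℕ) * (n + 1 : ℕ) : ℝ) 13 :=
    .of_run rfl le_rfl
  exact .mono_time (.comp (t' := 1) (.pair hx (.comp (t' := 1) (.pair hv hscale)
    (.of_run rfl le_rfl))) (.of_run rfl le_rfl)) (by lia)

theorem Computes.addScaled (x v : Fin n → ℝ) :
    Computes A V addScaled (n, (List.ofFn x, List.ofFn v))
      (List.ofFn (x + ((n + 1 : ℝ) ^ 2)⁻¹ • v)) (n * (n * 64 + 160) + 30) := by
  have hentry : x + ((n + 1 : ℝ) ^ 2)⁻¹ • v =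
      fun i => x i + v i / ((n + 1 : ℕ) * (n + 1 : ℕ)) := by
    ext i
    simp [sq, div_eq_inv_mul]
  rw [hentry]
  exact .mono_time (.comp (t := 3) (y := (n, (n, (List.ofFn x, List.ofFn v))))
    (.of_run rfl le_rfl) (.tabulate fun i => .addScaledEntry i x v)) (by lia)

/-- With presentation `w`, the program returns a maximiser over `K` of every linear objective. -/
def MaximizesOver (A V : List ℕ → ℝ) (p : Prog (.prod .pres (.list .real)) (.list .real))
    (w : Ty.pres.val) (K : Set (Fin n → ℝ)) (t : ℕ) : Prop :=
  ∀ c : Fin n → ℝ, Ensures A V p (w, List.ofFn c) t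
    (fun l => ∃ v ∈ K, l = List.ofFn v ∧ ∀ z ∈ K, ∑ i, c i * z i ≤ ∑ i, c i * v i)
    (fun _ => 0) 0

/-- A point of the polytope that nearly maximises the gradient of the multilinear extension at `x`,
on input `(w, x)`. -/
def direction (p : Prog (.prod .pres (.list .real)) (.list .real)) :
    Prog (.prod .pres (.list .real)) (.list .real) :=
  π₁ △ ((π₁ ⨾ π₁) △ π₂ ⨾ gradient) ⨾ p

theorem sum_mul_le_add_sum_abs_sub {u v G c : Fin n → ℝ} (hu : ∀ i, u i ∈ Set.Icc 0 1)
    (hv : ∀ i, v i ∈ Set.Icc 0 1) (hu' : ∀ i ∉ J, u i = 0) (hv' : ∀ i ∉ J, v i = 0)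
    (h : ∑ i, c i * u i ≤ ∑ i, c i * v i) :
    ∑ i, u i * G i ≤ ∑ i, v i * G i + ∑ i ∈ J, |c i - G i| := by
  have hterm (i : Fin n) : (v i - u i) * (c i - G i) ≤ |c i - G i| := by
    refine (le_abs_self _).trans ?_
    rw [abs_mul]
    exact mul_le_of_le_one_left (abs_nonneg _)
      (abs_le.2 ⟨by linarith [(hu i).2, (hv i).1], by linarith [(hu i).1, (hv i).2]⟩)
  calc ∑ i, u i * G i
      = ∑ i, v i * G i + ∑ i, (v i - u i) * (c i - G i)
          + (∑ i, c i * u i - ∑ i, c i * v i) := by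
        simp only [← Finset.sum_add_distrib, ← Finset.sum_sub_distrib]
        exact Finset.sum_congr rfl fun i _ => by ring
    _ ≤ ∑ i, v i * G i + ∑ i, (v i - u i) * (c i - G i) := by linarith
    _ = ∑ i, v i * G i + ∑ i ∈ J, (v i - u i) * (c i - G i) := by
        rw [Finset.sum_subset (Finset.subset_univ J) fun i _ hi => by rw [hu' i hi, hv' i hi]; ring]
    _ ≤ ∑ i, v i * G i + ∑ i ∈ J, |c i - G i| := by
        gcongr with i
        exact hterm i

theorem Ensures.direction (hf : Submodular f) (hm : Monotone f) (h0 : ∀ S, 0 ≤ f S)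
    (hK : ∀ z ∈ K, ∀ i, z i ∈ Set.Icc 0 1) (hJ : ∀ z ∈ K, ∀ i ∉ J, z i = 0) {desc : List ℝ}
    (hp : MaximizesOver A (valueOracle f) p (n, desc) K t)
    {x u : Fin n → ℝ} (hx : ∀ i, x i ∈ Set.Icc 0 1) (hu : u ∈ K) :
    Ensures A (valueOracle f) (direction p) ((n, desc), List.ofFn x)
      (n * (estimateTime n + 40) + t + 40) (fun l => ∃ v ∈ K, l = List.ofFn v)
      (fun l => ∑ i, u i * multilinear x Finset.univ (marginal i f) ∅ -
        ∑ i : Fin n, l.getD i 0 * multilinear x Finset.univ (marginal i f) ∅)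
      (gradientError f J) := by
  have hgrad : Ensures A (valueOracle f) (a := .prod .pres (.list .real))
      (π₁ △ ((π₁ ⨾ π₁) △ π₂ ⨾ SubmodMax.gradient)) ((n, desc), List.ofFn x)
      (n * (estimateTime n + 40) + 38) (fun z => z.1 = (n, desc) ∧ z.2.length = n)
      (fun z => ∑ j ∈ J, |z.2.getD j 0 - multilinear x Finset.univ (marginal j f) ∅|)
      (gradientError f J) :=
    .mono_time (.pair (t := 1) (.of_run rfl le_rfl) (.mono (.precomp (t := 5) (.of_run rfl le_rfl)
      (.gradient hf hm h0 hx J)) le_rfl (fun _ hl => ⟨rfl, hl⟩) (fun _ _ => le_rfl) le_rfl))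
      (by lia)
  refine .mono_time (.comp hgrad ?_) (t := n * (estimateTime n + 40) + 38 + t + 1) (by lia)
  rintro ⟨_, l⟩ ⟨rfl, hl⟩
  have hmax := ofFn_getD hl ▸ hp fun i => l.getD i 0
  refine (hmax.of_forall_le ?_).mono le_rfl ?_ (fun _ _ => le_rfl) le_rfl
  · rintro _ ⟨v, hv, rfl, hle⟩
    simp only [getD_ofFn]
    exact sub_le_iff_le_add'.2
      (sum_mul_le_add_sum_abs_sub (hK u hu) (hK v hv) (hJ u hu) (hJ v hv) (hle u hu))
  · rintro _ ⟨v, hv, rfl, -⟩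
    exact ⟨v, hv, rfl⟩

/-- With steps of length `(n + 1)⁻²`, at least this fraction of the first-order gain of the
continuous greedy algorithm is realised, and the estimation errors cost at most the remaining
fraction of the optimum. -/
noncomputable def stepEfficiency (n : ℕ) : ℝ := 1 - n / (n + 1) ^ 2

theorem stepEfficiency_mem_Icc (n : ℕ) : stepEfficiency n ∈ Set.Icc 0 1 := by
  have hle : (n : ℝ) / (n + 1) ^ 2 ≤ 1 := (div_le_one (by positivity)).2 (by nlinarith)
  exact ⟨sub_nonneg.2 hle, sub_le_self _ (by positivity)⟩

theorem gradientError_le (h0 : ∀ S, 0 ≤ f S) (hJ : ∀ j ∈ J, f {j} ≤ f O) :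
    gradientError f J ≤ (1 - stepEfficiency n) * f O := by
  have hcard : (J.card : ℝ) ≤ n := by exact_mod_cast card_finset_fin_le J
  calc gradientError f J ≤ J.card * (f O / (n + 1) ^ 2) := by
        rw [gradientError, ← nsmul_eq_mul]
        exact Finset.sum_le_card_nsmul _ _ _ fun j hj => by
          have := hJ j hj
          gcongr
    _ ≤ n * (f O / (n + 1) ^ 2) := by
        have := h0 O
        gcongr
    _ = (1 - stepEfficiency n) * f O := by
        rw [stepEfficiency]
        ring

theorem sub_multilinear_add_smul_le (hf : Submodular f) (hm : Monotone f) {x v : Fin n → ℝ}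
    (hx : ∀ i, x i ∈ Set.Icc 0 1) (hv : ∀ i, v i ∈ Set.Icc 0 1)
    (hxv : ∀ i, x i + ((n + 1 : ℝ) ^ 2)⁻¹ * v i ≤ 1) :
    f O - multilinear (x + ((n + 1 : ℝ) ^ 2)⁻¹ • v) Finset.univ f ∅ ≤
      stepEfficiency n / (n + 1) ^ 2 *
          (∑ i, (if i ∈ O then 1 else 0) * multilinear x Finset.univ (marginal i f) ∅ -
            ∑ i, v i * multilinear x Finset.univ (marginal i f) ∅) +
        (1 - stepEfficiency n / (n + 1) ^ 2) * (f O - multilinear x Finset.univ f ∅) := by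
  have hq : 0 ≤ stepEfficiency n / (n + 1 : ℝ) ^ 2 :=
    div_nonneg (stepEfficiency_mem_Icc n).1 (by positivity)
  have hgain := multilinear_add_smul_le hm hx hv (by positivity) hxv Finset.univ ∅
  have hopt : f O - multilinear x Finset.univ f ∅ ≤
      ∑ i, (if i ∈ O then 1 else 0) * multilinear x Finset.univ (marginal i f) ∅ := by
    simpa using hf.sub_multilinear_le hm hx Finset.univ O ∅
  rw [Finset.card_fin, ← div_eq_mul_inv, ← stepEfficiency, ← mul_assoc, ← div_eq_mul_inv] at hgain
  linarith [mul_le_mul_of_nonneg_left hopt hq]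

/-- One step of the continuous greedy algorithm, on input `(k, (w, x))`. -/
def greedyStep (p : Prog (.prod .pres (.list .real)) (.list .real)) :
    Prog (.prod .nat (.prod .pres (.list .real))) (.list .real) :=
  (π₂ ⨾ π₁ ⨾ π₁) △ (π₂ ⨾ π₂) △ (π₂ ⨾ direction p) ⨾ addScaled

/-- A bound on the running time of `greedyStep`, given a bound `t` on the running time of the linear
optimisation. -/
def greedyStepTime (n t : ℕ) : ℕ :=
  n * (estimateTime n + n * 64 + 200) + t + 90

theorem mem_Icc_of_mem_smul (hK : ∀ z ∈ K, ∀ i, z i ∈ Set.Icc 0 1) {r : ℝ}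
    (hr : r ∈ Set.Icc 0 1) {x : Fin n → ℝ} (hx : x ∈ r • K) (i : Fin n) : x i ∈ Set.Icc 0 1 := by
  obtain ⟨z, hz, rfl⟩ := hx
  exact ⟨mul_nonneg hr.1 (hK z hz i).1, mul_le_one₀ hr.2 (hK z hz i).1 (hK z hz i).2⟩

theorem Ensures.greedyStep (hf : Submodular f) (hm : Monotone f) (h0 : ∀ S, 0 ≤ f S)
    (hconv : Convex ℝ K) (hK : ∀ z ∈ K, ∀ i, z i ∈ Set.Icc 0 1) (hJ : ∀ z ∈ K, ∀ i ∉ J, z i = 0)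
    (hO : (fun i => if i ∈ O then (1 : ℝ) else 0) ∈ K) {desc : List ℝ}
    (hp : MaximizesOver A (valueOracle f) p (n, desc) K t) (k : ℕ) {r : ℝ} (hr : 0 ≤ r)
    (hr' : r + ((n + 1 : ℝ) ^ 2)⁻¹ ≤ 1) {x : Fin n → ℝ} (hx : x ∈ r • K) :
    Ensures A (valueOracle f) (greedyStep p) (k, ((n, desc), List.ofFn x)) (greedyStepTime n t)
      (fun l => ∃ y ∈ (r + ((n + 1 : ℝ) ^ 2)⁻¹) • K, l = List.ofFn y)
      (fun l => f O - gradientError f J -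
        multilinear (fun i : Fin n => l.getD i 0) Finset.univ f ∅)
      ((1 - stepEfficiency n / (n + 1) ^ 2) *
        (f O - gradientError f J - multilinear x Finset.univ f ∅)) := by
  have hδ : 0 ≤ ((n + 1 : ℝ) ^ 2)⁻¹ := by positivity
  have hx₁ := mem_Icc_of_mem_smul hK ⟨hr, (le_add_of_nonneg_right hδ).trans hr'⟩ hx
  have hmem {v} (hv : v ∈ K) : x + ((n + 1 : ℝ) ^ 2)⁻¹ • v ∈ (r + ((n + 1 : ℝ) ^ 2)⁻¹) • K :=
    hconv.add_smul hr hδ ▸ Set.add_mem_add hx (Set.smul_mem_smul_set hv)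
  have hxv {v} (hv : v ∈ K) (i : Fin n) : x i + ((n + 1 : ℝ) ^ 2)⁻¹ * v i ≤ 1 :=
    (mem_Icc_of_mem_smul hK ⟨add_nonneg hr hδ, hr'⟩ (hmem hv) i).2
  set q := stepEfficiency n / (n + 1 : ℝ) ^ 2
  have hdir := (Ensures.direction hf hm h0 hK hJ hp hx₁ hO).mul_add (c := q)
    (div_nonneg (stepEfficiency_mem_Icc n).1 (by positivity))
    ((1 - q) * (f O - multilinear x Finset.univ f ∅) - gradientError f J)
  have hinput : Ensures A (valueOracle f) (a := .prod .nat (.prod .pres (.list .real)))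
      ((π₂ ⨾ π₁ ⨾ π₁) △ (π₂ ⨾ π₂) △ (π₂ ⨾ SubmodMax.direction p)) (k, ((n, desc), List.ofFn x))
      (n * (estimateTime n + 40) + t + 54)
      (fun z => ∃ v ∈ K, z = (n, (List.ofFn x, List.ofFn v)))
      (fun z => f O - gradientError f J -
        multilinear (x + ((n + 1 : ℝ) ^ 2)⁻¹ • fun i : Fin n => z.2.2.getD i 0) Finset.univ f ∅)
      ((1 - q) * (f O - gradientError f J - multilinear x Finset.univ f ∅)) := by
    refine .mono_time (.pair (t := 5) (.of_run rfl le_rfl) (.pair (t := 3) (.of_run rfl le_rfl)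
      (.precomp (t := 1) (.of_run rfl le_rfl) (hdir.mono le_rfl ?_ ?_ ?_)))) (by lia)
    · rintro _ ⟨v, hv, rfl⟩
      exact ⟨v, hv, rfl⟩
    · rintro _ ⟨v, hv, rfl⟩
      simp only [getD_ofFn]
      linarith [sub_multilinear_add_smul_le hf hm (O := O) hx₁ (hK v hv) (hxv hv)]
    · exact le_of_eq (by ring)
  refine .mono_time (.comp hinput (t' := n * (n * 64 + 160) + 30) ?_)
    (by rw [greedyStepTime]; lia)
  rintro _ ⟨v, hv, rfl⟩
  refine ((Computes.addScaled x v).ensures ⟨_, hmem hv, rfl⟩).mono le_rfl (fun _ => id)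
    (fun _ _ => le_rfl) ?_
  simp only [getD_ofFn]
  exact le_rfl

/-- The number of steps, the presentation, and the starting point `0` of `greedy`. -/
def greedyStart : Prog .pres (.prod .nat (.prod .pres (.list .real))) :=
  (π₁ ⨾ .prim .natSucc ⨾ natSq) △ .prim .id △ tabulate (.prim .natZero ⨾ .prim .natCast)

theorem Computes.greedyStart (desc : List ℝ) :
    Computes A V greedyStart (n, desc) ((n + 1) ^ 2, ((n, desc), List.ofFn (0 : Fin n → ℝ)))
      (n * 66 + 89) := by
  have hsteps : Computes A V (a := .pres) (π₁ ⨾ .prim .natSucc ⨾ SubmodMax.natSq) (n, desc)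
      ((n + 1) ^ 2) (n * 23 + 53) :=
    .mono_time (.comp (t := 3) (y := n + 1) (.of_run rfl le_rfl) (.natSq _)) (by lia)
  have hzero (x : ℕ × List ℝ) : Computes A V (a := .prod .nat (.list .real))
      (.prim .natZero ⨾ .prim .natCast) x (0 : ℝ) 3 := by
    rw [← Nat.cast_zero (R := ℝ)]
    exact .of_run rfl le_rfl
  exact .mono_time (.pair hsteps (.pair (t := 1) (.of_run rfl le_rfl)
    (.tabulate (x := 0) fun _ => hzero _))) (by lia)

/-- The continuous greedy algorithm with steps of length `(n + 1)⁻²`. -/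
def greedy (p : Prog (.prod .pres (.list .real)) (.list .real)) : Prog .pres (.list .real) :=
  greedyStart ⨾ forDown (greedyStep p)

/-- A bound on the running time of `greedy`, given a bound `t` on the running time of the linear
optimisation. -/
def greedyTime (n t : ℕ) : ℕ :=
  (n + 1) ^ 2 * (greedyStepTime n t + 20) + n * 66 + 110

theorem stepEfficiency_div_le_one (n : ℕ) : stepEfficiency n / (n + 1) ^ 2 ≤ 1 :=
  div_le_one_of_le₀ ((stepEfficiency_mem_Icc n).2.trans
    (one_le_pow₀ (le_add_of_nonneg_left n.cast_nonneg))) (by positivity)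

theorem one_sub_stepEfficiency_div_pow_le (n : ℕ) :
    (1 - stepEfficiency n / (n + 1) ^ 2) ^ (n + 1) ^ 2 ≤ Real.exp (-stepEfficiency n) := by
  have hle : stepEfficiency n ≤ ((n + 1) ^ 2 : ℕ) := (stepEfficiency_mem_Icc n).2.trans
    (Nat.one_le_cast.2 (Nat.one_le_pow _ _ n.succ_pos))
  simpa using Real.one_sub_div_pow_le_exp_neg hle

theorem Ensures.forDown_greedyStep (hf : Submodular f) (hm : Monotone f) (h0 : ∀ S, 0 ≤ f S)
    (hconv : Convex ℝ K) (hK : ∀ z ∈ K, ∀ i, z i ∈ Set.Icc 0 1) (hJ : ∀ z ∈ K, ∀ i ∉ J, z i = 0)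
    (hO : (fun i => if i ∈ O then (1 : ℝ) else 0) ∈ K) {desc : List ℝ}
    (hp : MaximizesOver A (valueOracle f) p (n, desc) K t) :
    Ensures A (valueOracle f) (SubmodMax.forDown (SubmodMax.greedyStep p))
      ((n + 1) ^ 2, ((n, desc), List.ofFn (0 : Fin n → ℝ)))
      ((n + 1) ^ 2 * (greedyStepTime n t + 20) + 20) (fun l => ∃ x ∈ K, l = List.ofFn x)
      (fun l : List ℝ => f O - gradientError f J -
        multilinear (fun i : Fin n => l.getD i 0) Finset.univ f ∅)
      ((1 - stepEfficiency n / (n + 1) ^ 2) ^ (n + 1) ^ 2 *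
        (f O - gradientError f J - multilinear 0 Finset.univ f ∅)) := by
  set δ := ((n + 1 : ℝ) ^ 2)⁻¹ with hδ
  have hδ0 : 0 ≤ δ := by positivity
  have hδT : ((n + 1) ^ 2 : ℕ) * δ = 1 := by
    rw [hδ]
    push_cast
    exact mul_inv_cancel₀ (by positivity)
  let Inv (k : ℕ) (l : List ℝ) : Prop := ∃ x ∈ (1 - k * δ) • K, l = List.ofFn x
  let Φ (k : ℕ) (l : List ℝ) : ℝ := (1 - stepEfficiency n / (n + 1) ^ 2) ^ k *
    (f O - gradientError f J - multilinear (fun i : Fin n => l.getD i 0) Finset.univ f ∅)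
  have hstep : ∀ k < (n + 1) ^ 2, ∀ l : List ℝ, Inv (k + 1) l →
      Ensures A (valueOracle f) (SubmodMax.greedyStep p) (k, ((n, desc), l)) (greedyStepTime n t)
        (Inv k) (Φ k) (Φ (k + 1) l) := by
    rintro k hk _ ⟨x, hx, rfl⟩
    have hr : ((k + 1 : ℕ) : ℝ) * δ ≤ 1 := hδT ▸ by gcongr; lia
    have hr' : 1 - (k + 1 : ℕ) * δ + δ = 1 - k * δ := by
      push_cast
      ring
    have h := (Ensures.greedyStep hf hm h0 hconv hK hJ hO hp k (sub_nonneg.2 hr)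
      (hr'.trans_le (sub_le_self _ (mul_nonneg k.cast_nonneg hδ0))) hx).mul_add
        (c := (1 - stepEfficiency n / (n + 1) ^ 2) ^ k)
        (pow_nonneg (sub_nonneg.2 (stepEfficiency_div_le_one n)) k) 0
    rw [hr'] at h
    simpa only [Inv, Φ, getD_ofFn, add_zero, pow_succ, mul_assoc] using h
  have hloop := Ensures.forDown (s := .list .real) Inv Φ hstep (y := List.ofFn (0 : Fin n → ℝ))
    ⟨0, by rw [hδT, sub_self, Set.zero_smul_set ⟨_, hO⟩, Set.mem_zero], rfl⟩
  simpa only [Inv, Φ, getD_ofFn, Nat.cast_zero, zero_mul, sub_zero, one_smul, pow_zero,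
    one_mul] using hloop

theorem Ensures.greedy (hf : Submodular f) (hm : Monotone f) (h0 : ∀ S, 0 ≤ f S)
    (hconv : Convex ℝ K) (hK : ∀ z ∈ K, ∀ i, z i ∈ Set.Icc 0 1) (hJ : ∀ z ∈ K, ∀ i ∉ J, z i = 0)
    (hJO : ∀ j ∈ J, f {j} ≤ f O) (hO : (fun i => if i ∈ O then (1 : ℝ) else 0) ∈ K)
    {desc : List ℝ} (hp : MaximizesOver A (valueOracle f) p (n, desc) K t) :
    Ensures A (valueOracle f) (greedy p) (n, desc) (greedyTime n t)
      (fun l => ∃ x ∈ K, l = List.ofFn x)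
      (fun l : List ℝ => -multilinear (fun i : Fin n => l.getD i 0) Finset.univ f ∅)
      (-((stepEfficiency n - Real.exp (-stepEfficiency n)) * f O)) := by
  have hpow := one_sub_stepEfficiency_div_pow_le n
  set q := (1 - stepEfficiency n / (n + 1 : ℝ) ^ 2) ^ (n + 1) ^ 2
  have hq : 0 ≤ q := pow_nonneg (sub_nonneg.2 (stepEfficiency_div_le_one n)) _
  have herr := gradientError_le h0 hJO
  have herr0 : 0 ≤ gradientError f J :=
    Finset.sum_nonneg fun j _ => div_nonneg (h0 _) (by positivity)
  have hstart : 0 ≤ multilinear (0 : Fin n → ℝ) Finset.univ f ∅ :=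
    (h0 ∅).trans (le_multilinear hm (fun _ => ⟨le_rfl, zero_le_one⟩) _ ∅)
  have hgap : q * (f O - gradientError f J - multilinear 0 Finset.univ f ∅) ≤
      Real.exp (-stepEfficiency n) * f O :=
    (mul_le_mul_of_nonneg_left (by linarith) hq).trans (mul_le_mul_of_nonneg_right hpow (h0 O))
  refine ((Ensures.precomp (.greedyStart desc)
    (Ensures.forDown_greedyStep hf hm h0 hconv hK hJ hO hp)).mul_add zero_le_one
      (gradientError f J - f O)).mono ?_ (fun _ => id) (fun l _ => ?_) ?_
  · rw [greedyTime]
    lia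
  · exact le_of_eq (by ring)
  · linarith

end Greedy

/-! ## Rounding -/

section Rounding

variable {A V : List ℕ → ℝ} {n t t' : ℕ} {f : Finset (Fin n) → ℝ} {I : Finset (Finset (Fin n))}
  {O : Finset (Fin n)} {x : Fin n → ℝ} {p : Prog (.prod .pres (.list .real)) (.list .real)}
  {q : Prog (.prod .pres (.list .real)) (.list .nat)}

theorem apply_mem_of_mem_polytope {s : Set ℝ} (hs : Convex ℝ s) {i : Fin n}
    (h : ∀ S, Maximal (· ∈ I) S → (if i ∈ S then (1 : ℝ) else 0) ∈ s) (hx : x ∈ polytope I) :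
    x i ∈ s :=
  convexHull_min (t := (LinearMap.proj i : (Fin n → ℝ) →ₗ[ℝ] ℝ) ⁻¹' s)
    (by rintro _ ⟨S, hS, rfl⟩; exact h S hS) (hs.linear_preimage _) hx

theorem mem_Icc_of_mem_polytope (hx : x ∈ polytope I) (i : Fin n) : x i ∈ Set.Icc 0 1 :=
  apply_mem_of_mem_polytope (convex_Icc 0 1) (fun S _ => by split_ifs <;> simp) hx

theorem eq_zero_of_mem_polytope (hI : IsLowerSet (I : Set (Finset (Fin n)))) (hx : x ∈ polytope I)
    {i : Fin n} (hi : {i} ∉ I) : x i = 0 :=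
  apply_mem_of_mem_polytope (convex_singleton 0)
    (fun _ hS => if_neg fun h => hi (hI (Finset.singleton_subset_iff.2 h) hS.1)) hx

theorem MaximizesOver.nonempty {K : Set (Fin n → ℝ)} {w : Ty.pres.val}
    (hp : MaximizesOver A V p w K t) : K.Nonempty := by
  obtain ⟨D, -, -, hD, -⟩ := hp 0
  obtain ⟨o, ho⟩ := D.support_nonempty
  obtain ⟨v, hv, -⟩ := (hD o ho).2
  exact ⟨v, hv⟩

theorem exists_maximal_forall_le (hI : (polytope I).Nonempty) (hm : Monotone f) :
    ∃ O, Maximal (· ∈ I) O ∧ ∀ S ∈ I, f S ≤ f O := by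
  obtain ⟨_, S, hS, -⟩ := convexHull_nonempty_iff.1 hI
  obtain ⟨O₁, hO₁, hmax⟩ := I.exists_max_image f ⟨S, hS.1⟩
  obtain ⟨O, hle, hO⟩ := I.exists_le_maximal hO₁
  exact ⟨O, hO, fun S hS => (hmax S hS).trans (hm hle)⟩

theorem ensures_toSet_iff {a : Ty} {p : Prog a (.list .nat)} {y : a.val} {r : ℝ} :
    Ensures A V p y t (fun l => toSet n l ∈ I) (fun l => -f (toSet n l)) (-r) ↔
      ∃ D : PMF (List ℕ × ℕ), Eval A V p y D ∧ TimeAtMost (b := .list .nat) D t ∧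
        SupportedOn (outSet n D) I ∧ r ≤ expect (outSet n D) f := by
  have hmean {D : PMF (List ℕ × ℕ)} (hD : D.support.Finite) :
      mean D (fun o => -f (toSet n o.1)) = -expect (outSet n D) f := by
    rw [← mean_map (fun o : List ℕ × ℕ => toSet n o.1) hD fun S => -f S, ← expect_eq_mean]
    simp [expect, outSet]
  constructor
  · rintro ⟨D, hD, hfin, hQ, hr⟩
    refine ⟨D, hD, fun o ho => (hQ o ho).1, fun S hS => ?_, neg_le_neg_iff.1 (hmean hfin ▸ hr)⟩
    obtain ⟨o, ho, rfl⟩ := (PMF.mem_support_map_iff _ _ _).1 hS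
    exact (hQ o ho).2
  · rintro ⟨D, hD, hT, hI, hr⟩
    exact hD.ensures (fun o ho => ⟨hT o ho, hI _ ((PMF.mem_support_map_iff _ _ _).2 ⟨o, ho, rfl⟩)⟩)
      ((hmean hD.finite_support).trans_le (neg_le_neg hr))

/-- Continuous greedy, with the solver `p`, followed by rounding with the sampler `q`. -/
def maximize (p : Prog (.prod .pres (.list .real)) (.list .real))
    (q : Prog (.prod .pres (.list .real)) (.list .nat)) : Prog .pres (.list .nat) :=
  .prim .id △ greedy p ⨾ q

theorem Ensures.maximize (hf : Submodular f) (hm : Monotone f) (h0 : ∀ S, 0 ≤ f S)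
    (hI : IsLowerSet (I : Set (Finset (Fin n)))) (hO : Maximal (· ∈ I) O)
    (hmax : ∀ S ∈ I, f S ≤ f O) {desc : List ℝ}
    (hp : MaximizesOver A (valueOracle f) p (n, desc) (polytope I) t)
    (hq : ∀ x ∈ polytope I, ∃ D : PMF (List ℕ × ℕ),
      Eval A (valueOracle f) q ((n, desc), List.ofFn x) D ∧ TimeAtMost (b := .list .nat) D t' ∧
        SupportedOn (outSet n D) I ∧ IsWNR (outSet n D) ∧ HasMarginals (outSet n D) x) :
    Ensures A (valueOracle f) (maximize p q) (n, desc) (greedyTime n t + t' + 3)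
      (fun l => toSet n l ∈ I) (fun l => -f (toSet n l))
      (-((stepEfficiency n - Real.exp (-stepEfficiency n)) * f O)) := by
  have hgreedy := Ensures.greedy hf hm h0 (J := {i | {i} ∈ I}) (convex_convexHull ℝ _)
    (fun z hz => mem_Icc_of_mem_polytope hz)
    (fun z hz i hi => eq_zero_of_mem_polytope hI hz (by simpa using hi))
    (fun j hj => hmax _ (by simpa using hj)) (subset_convexHull ℝ _ ⟨O, hO, rfl⟩) hp
  refine .mono_time (t := 1 + greedyTime n t + 1 + t' + 1) (.comp (.pair (t := 1)
    (S := fun z : Ty.pres.val × List ℝ => ∃ x ∈ polytope I, z = ((n, desc), List.ofFn x))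
    (χ := fun z : Ty.pres.val × List ℝ =>
      -multilinear (fun i : Fin n => z.2.getD i 0) Finset.univ f ∅)
    (.of_run rfl le_rfl) (hgreedy.mono le_rfl ?_ (fun _ _ => le_rfl) le_rfl)) ?_) (by lia)
  · rintro _ ⟨x, hx, rfl⟩
    exact ⟨x, hx, rfl⟩
  · rintro _ ⟨x, hx, rfl⟩
    obtain ⟨D, hD, hT, hS, hwnr, hmarg⟩ := hq x hx
    simp only [getD_ofFn]
    exact ensures_toSet_iff.2 ⟨D, hD, hT, hS, hwnr.multilinear_le_expect hmarg hf⟩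

end Rounding

theorem exists_polynomial_greedyTime_le (P : Polynomial ℕ) :
    ∃ R : Polynomial ℕ, ∀ n s, n ≤ s → greedyTime n (P.eval s) ≤ R.eval s := by
  let estimateBound : Polynomial ℕ :=
    (.X + 1) ^ 4 * (.X * (.X * 32 + 100) + 70) + (.X + 1) ^ 2 * 23 + (.X + 1) * 23 + 120
  let stepBound : Polynomial ℕ := .X * (estimateBound + .X * 64 + 200) + P + 90
  refine ⟨(.X + 1) ^ 2 * (stepBound + 20) + .X * 66 + 110, fun n s hns => ?_⟩
  calc greedyTime n (P.eval s) ≤ greedyTime s (P.eval s) := by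
        simp only [greedyTime, greedyStepTime, estimateTime]
        gcongr
    _ = _ := by simp [estimateBound, stepBound, greedyTime, greedyStepTime, estimateTime]

/-- The amount by which the approximation guarantee falls short of `1 - 1 / e`. -/
noncomputable def approxLoss (n : ℕ) : ℝ :=
  1 - 1 / Real.exp 1 - (stepEfficiency n - Real.exp (-stepEfficiency n))

theorem tendsto_stepEfficiency : Filter.Tendsto stepEfficiency Filter.atTop (nhds 1) := by
  refine tendsto_of_tendsto_of_tendsto_of_le_of_le
    (by simpa using tendsto_one_div_add_atTop_nhds_zero_nat.const_sub (1 : ℝ)) tendsto_const_nhds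
    (fun n => ?_) fun n => (stepEfficiency_mem_Icc n).2
  rw [stepEfficiency]
  gcongr 1 - ?_
  rw [inv_eq_one_div, div_le_div_iff₀ (by positivity) (by positivity)]
  nlinarith

theorem tendsto_approxLoss : Filter.Tendsto approxLoss Filter.atTop (nhds 0) := by
  have h := (tendsto_stepEfficiency.sub
    ((Real.continuous_exp.tendsto _).comp tendsto_stepEfficiency.neg)).const_sub
      (1 - 1 / Real.exp 1)
  rwa [Real.exp_neg, one_div, sub_self, ← one_div] at h

end SubmodMax

open SubmodMax in
theorem theorem1p7 :
    ∃ ε : ℕ → ℝ, Filter.Tendsto ε Filter.atTop (nhds 0) ∧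
      ∀ C : Set Instance,
        (∀ X ∈ C, IsLowerSet (X.sets : Set (Finset (Fin X.n)))) →
        Solvable C →
        EfficientlyAdmitsWNR C →
        ∃ (p : Prog .pres (.list .nat)) (P : Polynomial ℕ),
          ∀ X ∈ C, ∀ f : Finset (Fin X.n) → ℝ,
            (∀ S, 0 ≤ f S) → Monotone f → Submodular f →
            ∃ D : PMF (List ℕ × ℕ),
              Eval X.oracle (valueOracle f) p X.pres D ∧
              TimeAtMost (b := .list .nat) D (P.eval X.size) ∧
              SupportedOn (outSet X.n D) X.sets ∧
              ∀ M : ℝ, IsGreatest (f '' (X.sets : Set (Finset (Fin X.n)))) M →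
                (1 - 1 / Real.exp 1 - ε X.n) * M ≤ expect (outSet X.n D) f := by
  refine ⟨approxLoss, tendsto_approxLoss, fun C hC ⟨p, P, hpV, hp⟩ ⟨q, Q, hqV, hq⟩ => ?_⟩
  obtain ⟨R, hR⟩ := exists_polynomial_greedyTime_le P
  refine ⟨maximize p q, R + Q + 3, fun X hX f h0 hm hf => ?_⟩
  have hsolve : MaximizesOver X.oracle (valueOracle f) p X.pres (polytope X.sets)
      (P.eval X.size) := fun c =>
    let ⟨_, hD, hT, hv⟩ := hp X hX c
    (hD.change_valueOracle hpV _).ensures (fun o ho => ⟨hT o ho, hv o ho⟩) (by simp [mean])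
  obtain ⟨O, hO, hmax⟩ := exists_maximal_forall_le hsolve.nonempty hm
  have happrox := Ensures.maximize hf hm h0 (hC X hX) hO hmax hsolve fun x hx =>
    let ⟨D, hD, hsample⟩ := hq X hX x hx
    ⟨D, hD.change_valueOracle hqV _, hsample⟩
  obtain ⟨D, hD, hT, hS, hr⟩ := ensures_toSet_iff.1 (happrox.mono_time
    (t' := (R + Q + 3).eval X.size) (by
      simpa [add_assoc] using hR X.n X.size (Nat.le_add_right _ _)))
  refine ⟨D, hD, hT, hS, fun M hM => ?_⟩
  rwa [hM.unique ⟨⟨O, hO.1, rfl⟩, Set.forall_mem_image.2 hmax⟩, approxLoss, sub_sub_cancel]
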